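/- **Setting.** Let $\Bbbk$ be an algebraically closed field of characteristic zero. For a lattice $N$ write $T_N = N\otimes\mathbb{G}_m=\operatorname{Spec}\Bbbk[\operatorname{Hom}(N,\mathbb{Z})]$, and for a rational polyhedral cone $\sigma\subseteq N\otimes\mathbb{R}$ write $N_\sigma = N\cap\operatorname{span}_{\mathbb R}(\sigma)$. Let $X$ be the toric variety of a fan $\Sigma$ in $N_\Sigma\otimes\mathbb{R}$ and let $\tau\subseteq N_\tau\otimes\mathbb{R}$ be a full-dimensional rational polyhedral cone, with affine toric variety $U_\tau$, torus-fixed point $0\in U_\tau$ and rubber torus $T_\tau=N_\tau\otimes\mathbb{G}_m$. Let $\Upsilon$ be a tropical expansion of $\Sigma$ over $\tau$, that is, a fan in $(N_\Sigma\times N_\tau)\otimes\mathbb{R}$, each cone of which is contained in $\sigma\times\tau$ for some $\sigma\in\Sigma$ (the support of $\Upsilon$ need not be all of $|\Sigma|\times\tau$), such that the projection $\mathrm{p}$ to $N_\tau\otimes\mathbb{R}$ maps every cone $\omega\in\Upsilon$ onto a face of $\tau$ and $N_\omega$ onto the lattice of that face. Let $\mathcal{X}_\Upsilon$ be the toric variety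 of $\Upsilon$, with the toric morphisms $\pi\colon\mathcal{X}_\Upsilon\to U_\tau$ and $\rho\colon\mathcal{X}_\Upsilon\to X$; let $\mathrm{r}$ be the projection to $N_\Sigma\otimes\mathbb{R}$. The rubber action $T_\tau\curvearrowright\mathcal{X}_\Upsilon$ is the restriction of the torus action along $T_\tau\hookrightarrow T_{N_\Sigma}\times T_\tau$. Let $P$ be a polyhedron of the polyhedral subdivision $\mathrm{p}^{-1}(\mathrm{f})$, $\mathrm{f}$ an interior point of $\tau$; equivalently, let $\omega_P\in\Upsilon$ be a cone with $\mathrm{p}(\omega_P)=\tau$, and for $\mathrm f\in\tau$ let $P_{\mathrm f}=\mathrm{r}(\omega_P\cap\mathrm{p}^{-1}(\mathrm f))$. Let $Y_P^\circ\subseteq\mathcal{X}_\Upsilon$ be the locally closed stratum (torus orbit) of $\omega_P$. Put $$K_P=\ker(N_{\omega_P}\to N_\tau)\subseteq N_\Sigma .$$ **Theorem.** There is a unique smallest cone $\sigma_P\in\Sigma$ containing $\mathrm r(\omega_P)$; let $X_P^\circ\subseteq X$ be its locally closed stratum, let $N_{\theta_P}=N_{\sigma_P}/K_P$, and let $\theta_P\subseteq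 N_{\theta_P}\otimes\mathbb{R}$ be the image of $\sigma_P$. The group $N_{\theta_P}$ is a lattice, the stratum $Y_P^\circ$ lies in the central fibre $\pi^{-1}(0)$, and: 1. $\rho$ restricts to a morphism $Y_P^\circ\to X_P^\circ$, and this is a principal torus bundle (Zariski-locally trivial) with structure group $T_{\theta_P}=N_{\theta_P}\otimes\mathbb{G}_m$. Here $T_{\theta_P}$ acts on $Y_P^\circ$ so that, along $T_{N_{\sigma_P}}\to T_{\theta_P}$, an element $t\in T_{N_{\sigma_P}}$ acts as $t^{-1}\in T_{N_{\sigma_P}}\subseteq T_{N_\Sigma}\subseteq T_{N_\Sigma}\times T_\tau$. 2. There is a unique linear map $\varphi_P\colon N_\tau\to N_{\theta_P}$ (the tropical position map) such that for every $\mathrm f\in\tau$ the polyhedron $P_{\mathrm f}\subseteq\sigma_P$ has image the point $\varphi_P(\mathrm f)$ in $\theta_P$; in particular $\varphi_P(\tau)\subseteq\theta_P$. The rubber action of $T_\tau$ preserves $Y_P^\circ$ and is given there by the homomorphism $\varphi_P\otimes\mathbb{G}_m\colon T_\tau\to T_{\theta_P}$ followed by the action of the structure group $T_{\theta_P}$.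 -/

import Mathlib

universe u
noncomputable section
open CategoryTheory AlgebraicGeometry Limits MonoidalCategory CartesianMonoidalCategory Opposite
open scoped TensorProduct

namespace Toric

section Lattice

/-- The real vector space `N_ℝ = ℝ ⊗ N` of a lattice `N`. -/
abbrev RealSpace (N : Type u) [AddCommGroup N] : Type u := ℝ ⊗[ℤ] N

/-- Convex cones in `N_ℝ` (containing the origin). -/
abbrev LatticeCone (N : Type u) [AddCommGroup N] : Type u := PointedCone ℝ (RealSpace N)

variable {N : Type u} [AddCommGroup N]

/-- The character lattice `M = Hom(N, ℤ)`. -/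
abbrev CharLattice (N : Type u) [AddCommGroup N] : Type u := N →+ ℤ

/-- The point `1 ⊗ n` of `N_ℝ` given by a lattice element `n`. -/
def latticePoint (n : N) : RealSpace N := (1 : ℝ) ⊗ₜ[ℤ] n

/-- The linear map `N_ℝ → N'_ℝ` induced by a homomorphism `N → N'`. -/
def realMap {N' : Type u} [AddCommGroup N'] (f : N →+ N') : RealSpace N →ₗ[ℝ] RealSpace N' :=
  f.toIntLinearMap.baseChange ℝ

/-- The linear functional on `N_ℝ` given by a character `m ∈ M`. -/
def pairing (m : CharLattice N) : RealSpace N →ₗ[ℝ] ℝ :=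
  Module.Dual.baseChange ℝ m.toIntLinearMap

lemma pairing_latticePoint (m : CharLattice N) (n : N) :
    pairing m (latticePoint n) = (m n : ℝ) := by
  simp [pairing, latticePoint]

lemma pairing_add (m m' : CharLattice N) (x : RealSpace N) :
    pairing (m + m') x = pairing m x + pairing m' x := by
  induction x using TensorProduct.induction_on with
  | zero => simp
  | tmul a n => simp [pairing, add_smul]
  | add x y hx hy => simp only [map_add, hx, hy]; ring

lemma pairing_zero (x : RealSpace N) :
    pairing (0 : CharLattice N) x = 0 := by
  induction x using TensorProduct.induction_on with
  | zero => simp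
  | tmul a n => simp [pairing]
  | add x y hx hy => simp only [map_add, hx, hy]; simp

lemma pairing_neg (m : CharLattice N) (x : RealSpace N) :
    pairing (-m) x = - pairing m x := by
  induction x using TensorProduct.induction_on with
  | zero => simp
  | tmul a n => simp [pairing]
  | add x y hx hy => simp only [map_add, hx, hy]; ring

lemma pairing_realMap {N' : Type u} [AddCommGroup N'] (f : N →+ N') (m : CharLattice N')
    (x : RealSpace N) : pairing m (realMap f x) = pairing (m.comp f) x := by
  induction x using TensorProduct.induction_on with
  | zero => simp
  | tmul a n => simp [pairing, realMap]
  | add x y hx hy => simp only [map_add, hx, hy]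

/-- The monoid `σ^∨ ∩ M` of characters that are nonnegative on `σ`. -/
def dualMonoid (σ : LatticeCone N) : AddSubmonoid (CharLattice N) where
  carrier := {m | ∀ x ∈ σ, 0 ≤ pairing m x}
  zero_mem' x _ := (pairing_zero x).ge
  add_mem' ha hb x hx := by
    rw [pairing_add]; exact add_nonneg (ha x hx) (hb x hx)

/-- The group `σ^⊥ ∩ M` of characters that vanish on `σ`. -/
def perp (σ : LatticeCone N) : AddSubgroup (CharLattice N) where
  carrier := {m | ∀ x ∈ σ, pairing m x = 0}
  zero_mem' x _ := pairing_zero x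
  add_mem' ha hb x hx := by
    rw [pairing_add, ha x hx, hb x hx, add_zero]
  neg_mem' ha x hx := by
    rw [pairing_neg, ha x hx, neg_zero]

lemma dualMonoid_anti {ρ σ : LatticeCone N} (h : ρ ≤ σ) : dualMonoid σ ≤ dualMonoid ρ :=
  fun _ hm x hx => hm x (h hx)

/-- The cone is generated by finitely many lattice points. -/
def IsRationalPolyhedral (σ : LatticeCone N) : Prop :=
  ∃ s : Finset N, σ = PointedCone.hull ℝ (latticePoint '' (s : Set N))

/-- The cone contains no line. -/
def IsStrictlyConvex (σ : LatticeCone N) : Prop := ∀ x ∈ σ, -x ∈ σ → x = 0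

/-- `ρ` is a face of the rational polyhedral cone `σ`: it is cut out of `σ` by a supporting
hyperplane `m^⊥` with `m ∈ σ^∨ ∩ M`. -/
def IsFace (ρ σ : LatticeCone N) : Prop :=
  ∃ m ∈ dualMonoid σ, ∀ x, x ∈ ρ ↔ x ∈ σ ∧ pairing m x = 0

/-- The lattice `N_σ = N ∩ span_ℝ(σ)` of a rational cone `σ`. -/
def coneLattice (σ : LatticeCone N) : AddSubgroup N where
  carrier := {n | latticePoint n ∈ Submodule.span ℝ (σ : Set (RealSpace N))}
  zero_mem' := by simp [latticePoint]
  add_mem' ha hb := by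
    simp only [Set.mem_ofPred_eq, latticePoint, TensorProduct.tmul_add] at *
    exact add_mem ha hb
  neg_mem' ha := by
    simp only [Set.mem_ofPred_eq, latticePoint, TensorProduct.tmul_neg] at *
    exact neg_mem ha

/-- A fan in `N_ℝ`. Finiteness is not imposed, so that finite fans are the ones that give toric
varieties of finite type; nothing below depends on it. -/
structure Fan (N : Type u) [AddCommGroup N] where
  cones : Set (LatticeCone N)
  rational : ∀ σ ∈ cones, IsRationalPolyhedral σ
  strictlyConvex : ∀ σ ∈ cones, IsStrictlyConvex σ
  face_mem : ∀ σ ∈ cones, ∀ ρ, IsFace ρ σ → ρ ∈ cones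
  inter_face : ∀ σ ∈ cones, ∀ σ' ∈ cones, IsFace (σ ⊓ σ') σ

lemma Fan.isFace_of_le (F : Fan N) {ρ σ : LatticeCone N} (hρ : ρ ∈ F.cones) (hσ : σ ∈ F.cones)
    (h : ρ ≤ σ) : IsFace ρ σ := by
  have := F.inter_face σ hσ ρ hρ
  rwa [inf_eq_right.mpr h] at this

lemma exists_add_nsmul_mem {σ ρ : LatticeCone N} (hσ : IsRationalPolyhedral σ)
    {m : CharLattice N} (hm : m ∈ dualMonoid σ) (hρ : ∀ x, x ∈ ρ ↔ x ∈ σ ∧ pairing m x = 0)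
    {w : CharLattice N} (hw : w ∈ dualMonoid ρ) : ∃ c : ℕ, w + c • m ∈ dualMonoid σ := by
  obtain ⟨s, rfl⟩ := hσ
  refine ⟨∑ v ∈ s, (w v).natAbs, ?_⟩
  intro x hx
  induction hx using Submodule.span_induction with
  | mem x h =>
    obtain ⟨v, hv, rfl⟩ := h
    rw [pairing_latticePoint]
    have hvσ : latticePoint v ∈ PointedCone.hull ℝ (latticePoint '' (s : Set N)) :=
      Submodule.subset_span ⟨v, hv, rfl⟩
    have h1 := hm _ hvσ
    rw [pairing_latticePoint] at h1
    norm_cast at h1 ⊢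
    simp only [AddMonoidHom.add_apply, AddMonoidHom.nsmul_apply, nsmul_eq_mul]
    rcases h1.eq_or_lt with h0 | h0
    · have h2 := hw (latticePoint v) ((hρ _).2 ⟨hvσ, by rw [pairing_latticePoint, ← h0]; simp⟩)
      rw [pairing_latticePoint] at h2
      norm_cast at h2
      rw [← h0]; simpa using h2
    · have h3 : (w v).natAbs ≤ ∑ v ∈ s, (w v).natAbs :=
        Finset.single_le_sum (f := fun v => (w v).natAbs) (fun _ _ => Nat.zero_le _) hv
      have h4 : ((∑ v ∈ s, (w v).natAbs : ℕ) : ℤ) ≤ (∑ v ∈ s, (w v).natAbs : ℕ) * m v := by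
        nlinarith [Int.natCast_nonneg (∑ v ∈ s, (w v).natAbs)]
      have : ((w v).natAbs : ℤ) ≤ (∑ v ∈ s, (w v).natAbs : ℕ) := by exact_mod_cast h3
      simp only [Int.natCast_natAbs] at this
      have := neg_abs_le (w v)
      simp at *
      linarith
  | zero => simp
  | add x y _ _ hx hy => rw [map_add]; exact add_nonneg hx hy
  | smul a x _ hx =>
    have : a • x = (a : ℝ) • x := rfl
    rw [this, map_smul]; exact mul_nonneg a.2 hx

end Lattice
section Alg
variable (k : Type u) [Field k]

/-- Schemes over `Spec k`. -/
abbrev SchemeOver : Type (u+1) := Over (Spec (CommRingCat.of k))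

variable {k}
/-- The `k`-scheme `Spec A` of a `k`-algebra `A`. -/
def specOf (A : Type u) [CommRing A] [Algebra k A] : SchemeOver k :=
  Over.mk (Spec.map (CommRingCat.ofHom (algebraMap k A)))

/-- The morphism of `k`-schemes given by a homomorphism of `k`-algebras. -/
def specMap {A B : Type u} [CommRing A] [CommRing B] [Algebra k A] [Algebra k B] (f : A →ₐ[k] B) :
    specOf (k := k) B ⟶ specOf A :=
  Over.homMk (Spec.map (CommRingCat.ofHom f.toRingHom)) (by
    simp [specOf, ← Spec.map_comp, ← CommRingCat.ofHom_comp])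

variable {A B C : Type u} [CommRing A] [CommRing B] [CommRing C]
  [Algebra k A] [Algebra k B] [Algebra k C]

lemma specMap_left (f : A →ₐ[k] B) :
    (specMap f).left = Spec.map (CommRingCat.ofHom f.toRingHom) := rfl

lemma specMap_id : specMap (AlgHom.id k A) = 𝟙 _ := by
  ext : 1
  exact Spec.map_id _

lemma specMap_comp (f : A →ₐ[k] B) (g : B →ₐ[k] C) :
    specMap g ≫ specMap f = specMap (g.comp f) := by
  ext : 1
  exact (Spec.map_comp _ _).symm

lemma pullbackSpecIso_hom_comp (A B : Type u) [CommRing A] [CommRing B] [Algebra k A]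
    [Algebra k B] :
    (pullbackSpecIso k A B).hom ≫ Spec.map (CommRingCat.ofHom (algebraMap k (A ⊗[k] B))) =
      pullback.fst _ _ ≫ Spec.map (CommRingCat.ofHom (algebraMap k A)) := by
  rw [← Iso.eq_inv_comp, ← Category.assoc, pullbackSpecIso_inv_fst, ← Spec.map_comp,
    ← CommRingCat.ofHom_comp]

/-- `Spec A × Spec B = Spec (A ⊗ B)`, products being taken over `Spec k`. -/
def specProd (A B : Type u) [CommRing A] [CommRing B] [Algebra k A] [Algebra k B] :
    specOf (k := k) A ⊗ specOf B ≅ specOf (k := k) (A ⊗[k] B) :=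
  Over.isoMk (pullbackSpecIso k A B) (pullbackSpecIso_hom_comp A B)

lemma specProd_inv_fst : (specProd A B).inv ≫ fst _ _ = specMap (Algebra.TensorProduct.includeLeft : A →ₐ[k] A ⊗[k] B) := by
  ext : 1
  exact pullbackSpecIso_inv_fst ..

lemma specProd_inv_snd : (specProd A B).inv ≫ snd _ _ = specMap (Algebra.TensorProduct.includeRight : B →ₐ[k] A ⊗[k] B) := by
  ext : 1
  exact pullbackSpecIso_inv_snd ..

/-- The group scheme structure on the spectrum of a Hopf algebra. -/
instance (A : Type u) [CommRing A] [HopfAlgebra k A] : GrpObj (specOf (k := k) A) :=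
  inferInstanceAs (GrpObj ((Spec (.of A)).asOver (Spec (.of k))))

lemma whiskerLeft_specProd (f : A →ₐ[k] B) :
    specOf C ◁ specMap f ≫ (specProd C A).hom = (specProd C B).hom ≫
      specMap (Algebra.TensorProduct.map (AlgHom.id k C) f) := by
  rw [← Iso.eq_comp_inv, Category.assoc, ← Iso.inv_comp_eq]
  apply CartesianMonoidalCategory.hom_ext
  · simp only [Category.assoc, whiskerLeft_fst, specProd_inv_fst, specMap_comp]
    congr 1
    ext : 1; simp
  · simp only [Category.assoc, whiskerLeft_snd, specProd_inv_snd, specMap_comp]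
    rw [← Category.assoc, specProd_inv_snd, specMap_comp]
    congr 1


lemma isOpenImmersion_specMap (f : A →ₐ[k] B) (a : A) (h : @IsLocalization.Away _ _ a B _ f.toRingHom.toAlgebra) :
  IsOpenImmersion (specMap f).left := by
  rw [specMap_left]
  let _ := f.toRingHom.toAlgebra
  exact IsOpenImmersion.of_isLocalization (S := B) a

variable {M : Type u} [AddCommGroup M]

/-- The inclusion of monoid algebras `k[S] → k[S']` for `S ⊆ S'`. -/
def inclAlg {S S' : AddSubmonoid M} (h : S ≤ S') : AddMonoidAlgebra k S →ₐ[k] AddMonoidAlgebra k S' :=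
  AddMonoidAlgebra.mapDomainAlgHom k k (AddSubmonoid.inclusion h)

lemma isLocalization_inclAlg {S S' : AddSubmonoid M} (h : S ≤ S') (s : S) (hs : -(s : M) ∈ S')
   (H : ∀ w ∈ S', ∃ c : ℕ, w + c • (s : M) ∈ S) :
   @IsLocalization.Away _ _ (AddMonoidAlgebra.single s (1 : k)) (AddMonoidAlgebra k S') _
     (inclAlg (k := k) h).toRingHom.toAlgebra := by
  let _ := (inclAlg (k := k) h).toRingHom.toAlgebra
  have hmap : ∀ x, algebraMap (AddMonoidAlgebra k S) (AddMonoidAlgebra k S') x = inclAlg (k := k) h x := fun _ => rfl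
  have hsingle : ∀ (x : S) (r : k), inclAlg (k := k) h (AddMonoidAlgebra.single x r) = AddMonoidAlgebra.single (AddSubmonoid.inclusion h x) r := by
    intro x r; simp [inclAlg]
  have hpow : ∀ (n : ℕ), (AddMonoidAlgebra.single s (1 : k)) ^ n = AddMonoidAlgebra.single (n • s) 1 := by
    intro n; simp [AddMonoidAlgebra.single_pow]
  refine { map_units := ?_, surj := ?_, exists_of_eq := ?_ }
  · rintro ⟨_, n, rfl⟩
    simp only [hmap, map_pow]
    apply IsUnit.pow
    rw [hsingle]
    refine IsUnit.of_mul_eq_one (AddMonoidAlgebra.single (⟨-(s : M), hs⟩ : S') 1) ?_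
    rw [AddMonoidAlgebra.single_mul_single, AddMonoidAlgebra.one_def]
    congr 1
    · ext; simp
    · simp
  · have key : ∀ z : AddMonoidAlgebra k S', ∃ (n : ℕ) (a : AddMonoidAlgebra k S),
        z * inclAlg (k := k) h (AddMonoidAlgebra.single s (1 : k) ^ n) = inclAlg (k := k) h a := by
      intro z
      induction z using AddMonoidAlgebra.induction_linear with
      | zero => exact ⟨0, 0, by simp⟩
      | add f g hf hg =>
        obtain ⟨n, a, ha⟩ := hf
        obtain ⟨n', a', ha'⟩ := hg
        refine ⟨n + n', a * AddMonoidAlgebra.single s (1 : k) ^ n' + a' * AddMonoidAlgebra.single s (1 : k) ^ n, ?_⟩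
        simp only [map_add, map_mul, ← ha, ← ha', pow_add]; ring
      | single w r =>
        obtain ⟨c, hc⟩ := H w w.2
        refine ⟨c, AddMonoidAlgebra.single ⟨_, hc⟩ r, ?_⟩
        rw [hpow, hsingle, hsingle, AddMonoidAlgebra.single_mul_single]
        congr 1
        · simp
    intro z
    obtain ⟨n, a, ha⟩ := key z
    exact ⟨(a, ⟨_, n, rfl⟩), ha⟩
  · intro x y hxy
    refine ⟨1, ?_⟩
    congr 1
    rw [hmap, hmap] at hxy
    exact AddMonoidAlgebra.mapDomain_injective (AddSubmonoid.inclusion_injective h) hxy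

end Alg
section Variety
variable (k : Type u) [Field k] {N : Type u} [AddCommGroup N]

/-- The affine toric variety `U_σ = Spec k[σ^∨ ∩ M]`. -/
abbrev affineChart (σ : LatticeCone N) : SchemeOver k :=
  specOf (AddMonoidAlgebra k (dualMonoid σ))

/-- The morphism `U_ρ → U_σ` for `ρ ⊆ σ`; an open immersion if `ρ` is a face of `σ`. -/
def chartMap {ρ σ : LatticeCone N} (h : ρ ≤ σ) : affineChart k ρ ⟶ affineChart k σ :=
  specMap (inclAlg (dualMonoid_anti h))

variable {k} in
lemma algHom_ext_single {M A : Type u} [AddCommMonoid M] [CommRing A] [Algebra k A]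
    {f g : AddMonoidAlgebra k M →ₐ[k] A}
    (h : ∀ x, f (AddMonoidAlgebra.single x 1) = g (AddMonoidAlgebra.single x 1)) : f = g :=
  AddMonoidAlgebra.algHom_ext' (MonoidHom.ext fun x => h x.toAdd) (by ext)

lemma inclAlg_refl {M : Type u} [AddCommGroup M] (S : AddSubmonoid M) :
    inclAlg (k := k) (le_refl S) = AlgHom.id k _ := by
  refine algHom_ext_single fun x => ?_
  simp [inclAlg]
  rfl

lemma inclAlg_comp {M : Type u} [AddCommGroup M] {S S' S'' : AddSubmonoid M} (h : S ≤ S')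
    (h' : S' ≤ S'') :
    (inclAlg (k := k) h').comp (inclAlg h) = inclAlg (h.trans h') := by
  refine algHom_ext_single fun x => ?_
  simp [inclAlg]
  rfl

lemma chartMap_refl (σ : LatticeCone N) : chartMap k (le_refl σ) = 𝟙 _ := by
  rw [chartMap, inclAlg_refl, specMap_id]

lemma chartMap_comp {π ρ σ : LatticeCone N} (h : π ≤ ρ) (h' : ρ ≤ σ) :
    chartMap k h ≫ chartMap k h' = chartMap k (h.trans h') := by
  rw [chartMap, chartMap, specMap_comp, inclAlg_comp]; rfl

lemma chartMap_aux {ρ σ : LatticeCone N} (hσ : IsRationalPolyhedral σ) (h : ρ ≤ σ)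
    {m : CharLattice N} (hm : m ∈ dualMonoid σ) (hρ : ∀ x, x ∈ ρ ↔ x ∈ σ ∧ pairing m x = 0) :
    @IsLocalization.Away _ _ (AddMonoidAlgebra.single (⟨m, hm⟩ : dualMonoid σ) (1 : k))
      (AddMonoidAlgebra k (dualMonoid ρ)) _
      (inclAlg (k := k) (dualMonoid_anti h)).toRingHom.toAlgebra := by
  refine isLocalization_inclAlg _ _ ?_ ?_
  · intro x hx
    rw [pairing_neg, ((hρ x).1 hx).2, neg_zero]
  · intro w hw
    exact exists_add_nsmul_mem hσ hm hρ hw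

lemma isOpenImmersion_chartMap {ρ σ : LatticeCone N} (hσ : IsRationalPolyhedral σ) (h : ρ ≤ σ)
    (hf : IsFace ρ σ) : IsOpenImmersion (chartMap k h).left := by
  obtain ⟨m, hm, hρ⟩ := hf
  exact isOpenImmersion_specMap _ _ (chartMap_aux k hσ h hm hρ)

lemma range_chartMap {ρ σ : LatticeCone N} (hσ : IsRationalPolyhedral σ) (h : ρ ≤ σ)
    {m : CharLattice N} (hm : m ∈ dualMonoid σ) (hρ : ∀ x, x ∈ ρ ↔ x ∈ σ ∧ pairing m x = 0) :
    Set.range (chartMap k h).left = (PrimeSpectrum.basicOpen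
      (AddMonoidAlgebra.single (⟨m, hm⟩ : dualMonoid σ) (1 : k)) : Set (PrimeSpectrum _)) := by
  let _ := (inclAlg (k := k) (dualMonoid_anti h)).toRingHom.toAlgebra
  have := chartMap_aux k hσ h hm hρ
  exact PrimeSpectrum.localization_away_comap_range (AddMonoidAlgebra k (dualMonoid ρ)) _

namespace Fan
variable (F : Fan N)

/-- The diagram of affine toric varieties `U_σ` indexed by the cones of the fan, ordered by inclusion
(which is the face relation), with the open immersions `U_ρ → U_σ`. -/
def diagram : F.cones ⥤ SchemeOver k where
  obj σ := affineChart k σ.1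
  map f := chartMap k (leOfHom f)
  map_id σ := chartMap_refl k σ.1
  map_comp f g := (chartMap_comp k (leOfHom f) (leOfHom g)).symm

instance {ρ σ : F.cones} (f : ρ ⟶ σ) : IsOpenImmersion ((F.diagram k).map f).left :=
  isOpenImmersion_chartMap k (F.rational _ σ.2) (leOfHom f) (F.isFace_of_le ρ.2 σ.2 (leOfHom f))

instance {ρ σ : F.cones} (f : ρ ⟶ σ) : IsOpenImmersion ((F.diagram k ⋙ Over.forget _).map f) :=
  inferInstanceAs (IsOpenImmersion ((F.diagram k).map f).left)

lemma inter_mem {σ σ' : LatticeCone N} (h : σ ∈ F.cones) (h' : σ' ∈ F.cones) :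
    σ ⊓ σ' ∈ F.cones := F.face_mem _ h _ (F.inter_face _ h _ h')

instance : (F.diagram k ⋙ Over.forget _ ⋙ Scheme.forget).IsLocallyDirected where
  cond := by
    intro i j l fi fj xi xj hx
    obtain ⟨m, hm, hi⟩ := F.isFace_of_le i.2 l.2 (leOfHom fi)
    obtain ⟨m', hm', hj⟩ := F.isFace_of_le j.2 l.2 (leOfHom fj)
    have hx' : (chartMap k (leOfHom fi)).left xi = (chartMap k (leOfHom fj)).left xj := hx
    have hρ : ∀ x, x ∈ i.1 ⊓ j.1 ↔ x ∈ l.1 ∧ pairing (m + m') x = 0 := by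
      intro x
      rw [Submodule.mem_inf, hi, hj, pairing_add]
      constructor
      · rintro ⟨⟨a, b⟩, ⟨_, c⟩⟩
        exact ⟨a, by rw [b, c, add_zero]⟩
      · rintro ⟨a, b⟩
        have h1 := hm x a
        have h2 := hm' x a
        exact ⟨⟨a, by linarith⟩, ⟨a, by linarith⟩⟩
    have h1 : (chartMap k (leOfHom fi)).left xi ∈ Set.range (chartMap k (leOfHom fi)).left :=
      ⟨_, rfl⟩
    have h2 : (chartMap k (leOfHom fi)).left xi ∈ Set.range (chartMap k (leOfHom fj)).left := by
      rw [hx']; exact ⟨_, rfl⟩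
    rw [range_chartMap k (F.rational _ l.2) _ hm hi] at h1
    rw [range_chartMap k (F.rational _ l.2) _ hm' hj] at h2
    have h3 : (chartMap k (leOfHom fi)).left xi ∈
        Set.range (chartMap k ((inf_le_left.trans (leOfHom fi) : i.1 ⊓ j.1 ≤ l.1))).left := by
      rw [range_chartMap k (F.rational _ l.2) _ (add_mem hm hm') hρ]
      have e : (AddMonoidAlgebra.single (⟨m + m', add_mem hm hm'⟩ : dualMonoid l.1) (1 : k)) =
        AddMonoidAlgebra.single ⟨m, hm⟩ 1 * AddMonoidAlgebra.single ⟨m', hm'⟩ 1 := by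
        rw [AddMonoidAlgebra.single_mul_single]; simp
      rw [e, PrimeSpectrum.basicOpen_mul]
      exact ⟨h1, h2⟩
    obtain ⟨z, hz⟩ := h3
    refine ⟨⟨_, F.inter_mem i.2 j.2⟩, homOfLE (show i.1 ⊓ j.1 ≤ i.1 from inf_le_left),
      homOfLE (show i.1 ⊓ j.1 ≤ j.1 from inf_le_right), z, ?_, ?_⟩
    · have := isOpenImmersion_chartMap k (F.rational _ l.2) (leOfHom fi)
        (F.isFace_of_le i.2 l.2 (leOfHom fi))
      apply (chartMap k (leOfHom fi)).left.isOpenEmbedding.injective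
      rw [← hz, ← chartMap_comp k inf_le_left (leOfHom fi)]
      rfl
    · have := isOpenImmersion_chartMap k (F.rational _ l.2) (leOfHom fj)
        (F.isFace_of_le j.2 l.2 (leOfHom fj))
      apply (chartMap k (leOfHom fj)).left.isOpenEmbedding.injective
      rw [← hx', ← hz]
      have : chartMap k (inf_le_left.trans (leOfHom fi) : i.1 ⊓ j.1 ≤ l.1) =
        chartMap k inf_le_right ≫ chartMap k (leOfHom fj) := (chartMap_comp k _ _).symm
      rw [this]
      rfl

/-- The toric variety of a fan: the affine toric varieties `U_σ` glued along the `U_ρ` for common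
faces `ρ`. -/
def toricVariety : SchemeOver k := colimit (F.diagram k)

/-- The affine chart `U_σ` of the toric variety. -/
def chartι (σ : F.cones) : affineChart k σ.1 ⟶ F.toricVariety k := colimit.ι (F.diagram k) σ

lemma chartMap_chartι {ρ σ : F.cones} (h : ρ.1 ≤ σ.1) : chartMap k h ≫ F.chartι k σ = F.chartι k ρ :=
  colimit.w (F.diagram k) (homOfLE (show ρ ≤ σ from h))

lemma hom_ext {Z : SchemeOver k} {f g : F.toricVariety k ⟶ Z}
    (h : ∀ σ, F.chartι k σ ≫ f = F.chartι k σ ≫ g) : f = g := colimit.hom_ext h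

/-- Glueing of morphisms defined on the affine charts. -/
def desc {Z : SchemeOver k} (g : ∀ σ : F.cones, affineChart k σ.1 ⟶ Z)
    (hg : ∀ (ρ σ : F.cones) (h : ρ.1 ≤ σ.1), chartMap k h ≫ g σ = g ρ) : F.toricVariety k ⟶ Z :=
  
  colimit.desc (F.diagram k)
    { pt := Z
      ι :=
        { app := g
          naturality := fun ρ σ f => (hg ρ σ (leOfHom f)).trans (Category.comp_id (g ρ)).symm } }

lemma chartι_desc {Z : SchemeOver k} (g : ∀ σ : F.cones, affineChart k σ.1 ⟶ Z)
    (hg : ∀ (ρ σ : F.cones) (h : ρ.1 ≤ σ.1), chartMap k h ≫ g σ = g ρ) (σ : F.cones) :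
    F.chartι k σ ≫ F.desc k g hg = g σ := colimit.ι_desc _ _

instance instIsLocallyDirectedForget :
    ((F.diagram k ⋙ Over.forget _) ⋙ Scheme.forget).IsLocallyDirected :=
  inferInstanceAs (F.diagram k ⋙ Over.forget _ ⋙ Scheme.forget).IsLocallyDirected

/-- The underlying scheme of the toric variety is the glueing of the affine charts in schemes. -/
def leftIso : (F.toricVariety k).left ≅ colimit (F.diagram k ⋙ Over.forget _) :=
  preservesColimitIso (Over.forget _) (F.diagram k)

lemma chartι_left_leftIso (σ : F.cones) :
    (F.chartι k σ).left ≫ (F.leftIso k).hom = colimit.ι (F.diagram k ⋙ Over.forget _) σ :=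
  ι_preservesColimitIso_hom (Over.forget _) (F.diagram k) σ

lemma chartι_left (σ : F.cones) :
    (F.chartι k σ).left = colimit.ι (F.diagram k ⋙ Over.forget _) σ ≫ (F.leftIso k).inv := by
  exact (Iso.eq_comp_inv (F.leftIso k)).2 (F.chartι_left_leftIso k σ)

instance (σ : F.cones) : IsOpenImmersion (F.chartι k σ).left := by
  rw [chartι_left]
  have h : IsOpenImmersion (colimit.ι (F.diagram k ⋙ Over.forget _) σ) := inferInstance
  exact @IsOpenImmersion.comp _ _ _ _ _ h inferInstance

lemma chartι_jointly_surjective (x : (F.toricVariety k).left) :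
    ∃ (σ : F.cones) (y : (affineChart k σ.1).left), (F.chartι k σ).left y = x := by
  obtain ⟨σ, y, hy⟩ := Scheme.IsLocallyDirected.ι_jointly_surjective
    (F.diagram k ⋙ Over.forget _) ((F.leftIso k).hom x)
  refine ⟨σ, y, ?_⟩
  rw [chartι_left]
  change (F.leftIso k).inv (colimit.ι (F.diagram k ⋙ Over.forget _) σ y) = x
  rw [hy]
  simp

lemma chartι_eq_chartι {ρ σ : F.cones} (x : (affineChart k ρ.1).left)
    (y : (affineChart k σ.1).left) (h : (F.chartι k ρ).left x = (F.chartι k σ).left y) :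
    ∃ (π : F.cones) (h₁ : π.1 ≤ ρ.1) (h₂ : π.1 ≤ σ.1) (z : (affineChart k π.1).left),
      (chartMap k h₁).left z = x ∧ (chartMap k h₂).left z = y := by
  have h' := congrArg (F.leftIso k).hom h
  rw [← Scheme.Hom.comp_apply, ← Scheme.Hom.comp_apply, chartι_left_leftIso,
    chartι_left_leftIso] at h'
  obtain ⟨π, f, g, z, hz⟩ := (Scheme.IsLocallyDirected.ι_eq_ι_iff _).1 h'
  exact ⟨π, leOfHom f, leOfHom g, z, hz⟩

/-- The cover of a toric variety by its affine charts. -/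
abbrev cover : (F.toricVariety k).left.OpenCover where
  I₀ := F.cones
  X σ := (affineChart k σ.1).left
  f σ := (F.chartι k σ).left
  mem₀ := by
    rw [Scheme.presieve₀_mem_precoverage_iff]
    exact ⟨fun x => F.chartι_jointly_surjective k x, fun σ => inferInstance⟩

lemma chartMap_left_chartι_left {ρ σ : F.cones} (h : ρ.1 ≤ σ.1) :
    (chartMap k h).left ≫ (F.chartι k σ).left = (F.chartι k ρ).left :=
  congrArg Over.Hom.left (F.chartMap_chartι k h)

lemma cover_directed (ρ σ : F.cones)
    (x : (pullback (F.chartι k ρ).left (F.chartι k σ).left).carrier) :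
    ∃ (π : F.cones) (h₁ : π.1 ≤ ρ.1) (h₂ : π.1 ≤ σ.1) (z : (affineChart k π.1).left),
      pullback.lift (f := (F.chartι k ρ).left) (g := (F.chartι k σ).left)
        (chartMap k h₁).left (chartMap k h₂).left
        (by rw [chartMap_left_chartι_left, chartMap_left_chartι_left]) z = x := by
  have hx : (F.chartι k ρ).left (pullback.fst (F.chartι k ρ).left (F.chartι k σ).left x) =
      (F.chartι k σ).left (pullback.snd (F.chartι k ρ).left (F.chartι k σ).left x) := by
    rw [← Scheme.Hom.comp_apply, ← Scheme.Hom.comp_apply, pullback.condition]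
  obtain ⟨π, h₁, h₂, z, hz₁, hz₂⟩ := F.chartι_eq_chartι k _ _ hx
  refine ⟨π, h₁, h₂, z, ?_⟩
  apply (pullback.fst (F.chartι k ρ).left (F.chartι k σ).left).isOpenEmbedding.injective
  rw [← Scheme.Hom.comp_apply, pullback.lift_fst]
  exact hz₁

instance : (F.cover k).LocallyDirected where
  trans {ρ σ} f := (chartMap k (leOfHom f)).left
  trans_id σ := congrArg Over.Hom.left (chartMap_refl k σ.1)
  trans_comp {π ρ σ} f g := congrArg Over.Hom.left (chartMap_comp k (leOfHom f) (leOfHom g)).symm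
  w {ρ σ} f := F.chartMap_left_chartι_left k (leOfHom f)
  directed {ρ σ} x := by
    obtain ⟨π, h₁, h₂, z, hz⟩ := F.cover_directed k ρ σ x
    exact ⟨π, homOfLE h₁, homOfLE h₂, z, hz⟩
  property_trans {ρ σ} f :=
    isOpenImmersion_chartMap k (F.rational _ σ.2) _ (F.isFace_of_le ρ.2 σ.2 (leOfHom f))

section DescTensor
variable (T : SchemeOver k)

abbrev tensorCover : (T ⊗ F.toricVariety k).left.OpenCover :=
  (F.cover k).pullback₁ (snd T (F.toricVariety k)).left

/-- The preimage of the chart `U_σ` in `T × X`. -/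
def tensorPiece (σ : F.cones) : SchemeOver k :=
  Over.mk (pullback.fst (snd T (F.toricVariety k)).left (F.chartι k σ).left ≫
    (T ⊗ F.toricVariety k).hom)

def tensorPieceFst (σ : F.cones) : F.tensorPiece k T σ ⟶ T ⊗ F.toricVariety k :=
  Over.homMk (pullback.fst _ _)

lemma tensorPiece_w (σ : F.cones) :
    pullback.snd (snd T (F.toricVariety k)).left (F.chartι k σ).left ≫ (affineChart k σ.1).hom =
      pullback.fst (snd T (F.toricVariety k)).left (F.chartι k σ).left ≫
        (T ⊗ F.toricVariety k).hom := by
  rw [← Over.w (F.chartι k σ), ← Over.w (snd T (F.toricVariety k)), ← Category.assoc,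
    ← Category.assoc, pullback.condition]

def tensorPieceSnd (σ : F.cones) : F.tensorPiece k T σ ⟶ affineChart k σ.1 :=
  Over.homMk (pullback.snd (snd T (F.toricVariety k)).left (F.chartι k σ).left)
    (F.tensorPiece_w k T σ)

def tensorPieceHom (σ : F.cones) : F.tensorPiece k T σ ⟶ T ⊗ affineChart k σ.1 :=
  lift (F.tensorPieceFst k T σ ≫ fst _ _) (F.tensorPieceSnd k T σ)

lemma tensorPieceFst_snd (σ : F.cones) :
    F.tensorPieceFst k T σ ≫ snd _ _ = F.tensorPieceSnd k T σ ≫ F.chartι k σ :=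
  Over.OverMorphism.ext pullback.condition

def tensorPieceMapLeft {ρ σ : F.cones} (h : ρ.1 ≤ σ.1) :
    pullback (snd T (F.toricVariety k)).left (F.chartι k ρ).left ⟶
      pullback (snd T (F.toricVariety k)).left (F.chartι k σ).left :=
  pullback.map _ _ _ _ (𝟙 _) (chartMap k h).left (𝟙 _) (by simp)
    (by rw [Category.comp_id]; exact (F.chartMap_left_chartι_left k h).symm)

lemma tensorPieceMapLeft_fst {ρ σ : F.cones} (h : ρ.1 ≤ σ.1) :
    F.tensorPieceMapLeft k T h ≫ pullback.fst _ _ = pullback.fst _ _ := by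
  rw [tensorPieceMapLeft, pullback.map, pullback.lift_fst, Category.comp_id]

lemma tensorPieceMapLeft_snd {ρ σ : F.cones} (h : ρ.1 ≤ σ.1) :
    F.tensorPieceMapLeft k T h ≫ pullback.snd _ _ = pullback.snd _ _ ≫ (chartMap k h).left := by
  rw [tensorPieceMapLeft, pullback.map, pullback.lift_snd]

def tensorPieceMap {ρ σ : F.cones} (h : ρ.1 ≤ σ.1) :
    F.tensorPiece k T ρ ⟶ F.tensorPiece k T σ :=
  Over.homMk (F.tensorPieceMapLeft k T h) (by
    change F.tensorPieceMapLeft k T h ≫ pullback.fst _ _ ≫ (T ⊗ F.toricVariety k).hom =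
      pullback.fst _ _ ≫ (T ⊗ F.toricVariety k).hom
    rw [← Category.assoc, tensorPieceMapLeft_fst])

lemma tensorPieceMap_fst {ρ σ : F.cones} (h : ρ.1 ≤ σ.1) :
    F.tensorPieceMap k T h ≫ F.tensorPieceFst k T σ = F.tensorPieceFst k T ρ :=
  Over.OverMorphism.ext (F.tensorPieceMapLeft_fst k T h)

lemma tensorPieceMap_snd {ρ σ : F.cones} (h : ρ.1 ≤ σ.1) :
    F.tensorPieceMap k T h ≫ F.tensorPieceSnd k T σ =
      F.tensorPieceSnd k T ρ ≫ chartMap k h :=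
  Over.OverMorphism.ext (F.tensorPieceMapLeft_snd k T h)

lemma tensorPieceMap_hom {ρ σ : F.cones} (h : ρ.1 ≤ σ.1) :
    F.tensorPieceMap k T h ≫ F.tensorPieceHom k T σ =
      F.tensorPieceHom k T ρ ≫ T ◁ chartMap k h := by
  apply CartesianMonoidalCategory.hom_ext
  · simp only [tensorPieceHom, Category.assoc, lift_fst, whiskerLeft_fst]
    rw [← Category.assoc, tensorPieceMap_fst]
  · simp only [tensorPieceHom, Category.assoc, lift_snd, whiskerLeft_snd, lift_snd_assoc]
    exact tensorPieceMap_snd k F T h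

def tensorPieceInv (σ : F.cones) : T ⊗ affineChart k σ.1 ⟶ F.tensorPiece k T σ :=
  Over.homMk (pullback.lift (T ◁ F.chartι k σ).left (snd T (affineChart k σ.1)).left
    (congrArg Over.Hom.left (whiskerLeft_snd T (F.chartι k σ)))) (by
    change pullback.lift _ _ _ ≫ pullback.fst _ _ ≫ (T ⊗ F.toricVariety k).hom = _
    rw [pullback.lift_fst_assoc]
    exact Over.w (T ◁ F.chartι k σ))

lemma tensorPieceInv_fst (σ : F.cones) :
    F.tensorPieceInv k T σ ≫ F.tensorPieceFst k T σ = T ◁ F.chartι k σ :=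
  Over.OverMorphism.ext (pullback.lift_fst _ _ _)

lemma tensorPieceInv_snd (σ : F.cones) :
    F.tensorPieceInv k T σ ≫ F.tensorPieceSnd k T σ = snd _ _ :=
  Over.OverMorphism.ext (pullback.lift_snd _ _ _)

lemma tensorPieceInv_hom (σ : F.cones) :
    F.tensorPieceInv k T σ ≫ F.tensorPieceHom k T σ = 𝟙 _ := by
  apply CartesianMonoidalCategory.hom_ext
  · simp only [tensorPieceHom, Category.assoc, lift_fst, Category.id_comp]
    rw [← Category.assoc, tensorPieceInv_fst, whiskerLeft_fst]
  · simp only [tensorPieceHom, Category.assoc, lift_snd, Category.id_comp]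
    exact tensorPieceInv_snd k F T σ

variable {T} {Z : SchemeOver k}

lemma tensorPieceMap_hom_comp (g : ∀ σ : F.cones, T ⊗ affineChart k σ.1 ⟶ Z)
    (hg : ∀ (ρ σ : F.cones) (h : ρ.1 ≤ σ.1), T ◁ chartMap k h ≫ g σ = g ρ)
    {ρ σ : F.cones} (h : ρ.1 ≤ σ.1) :
    F.tensorPieceMap k T h ≫ F.tensorPieceHom k T σ ≫ g σ = F.tensorPieceHom k T ρ ≫ g ρ := by
  rw [← Category.assoc, tensorPieceMap_hom, Category.assoc, hg]

/-- Glueing of morphisms `T × U_σ → Z` to a morphism `T × X → Z`. -/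
def descTensor (g : ∀ σ : F.cones, T ⊗ affineChart k σ.1 ⟶ Z)
    (hg : ∀ (ρ σ : F.cones) (h : ρ.1 ≤ σ.1), T ◁ chartMap k h ≫ g σ = g ρ) :
    T ⊗ F.toricVariety k ⟶ Z :=
  (F.tensorCover k T).glueMorphismsOverOfLocallyDirected
    (fun σ => (F.tensorPieceHom k T σ ≫ g σ).left)
    (fun f => congrArg Over.Hom.left (F.tensorPieceMap_hom_comp k g hg (leOfHom f)))
    (fun σ => Over.w (F.tensorPieceHom k T σ ≫ g σ))

lemma whiskerLeft_chartι_descTensor (g : ∀ σ : F.cones, T ⊗ affineChart k σ.1 ⟶ Z)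
    (hg : ∀ (ρ σ : F.cones) (h : ρ.1 ≤ σ.1), T ◁ chartMap k h ≫ g σ = g ρ) (σ : F.cones) :
    T ◁ F.chartι k σ ≫ F.descTensor k g hg = g σ := by
  have h : F.tensorPieceFst k T σ ≫ F.descTensor k g hg = F.tensorPieceHom k T σ ≫ g σ :=
    Over.OverMorphism.ext
      ((F.tensorCover k T).map_glueMorphismsOverOfLocallyDirected_left
        (fun σ => (F.tensorPieceHom k T σ ≫ g σ).left)
        (fun f => congrArg Over.Hom.left (F.tensorPieceMap_hom_comp k g hg (leOfHom f)))
        (fun σ => Over.w (F.tensorPieceHom k T σ ≫ g σ)) σ)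
  rw [← tensorPieceInv_fst, Category.assoc, h, ← Category.assoc, tensorPieceInv_hom,
    Category.id_comp]

end DescTensor
end Fan
section Torus

/-- The torus `T_N = N ⊗ 𝔾_m = Spec k[Hom(N, ℤ)]`. It is a group scheme via the Hopf algebra
structure of the group algebra. -/
abbrev torus (N : Type u) [AddCommGroup N] : SchemeOver k :=
  specOf (AddMonoidAlgebra k (CharLattice N))

/-- The homomorphism of tori `f ⊗ 𝔾_m : T_N → T_N'` given by a homomorphism `f : N → N'`. -/
def torusMap {N N' : Type u} [AddCommGroup N] [AddCommGroup N'] (f : N →+ N') :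
    torus k N ⟶ torus k N' :=
  specMap (AddMonoidAlgebra.mapDomainAlgHom k k (AddMonoidHom.compHom' f))

/-- The coaction `χ^m ↦ χ^m ⊗ χ^m`. -/
def coaction {M : Type u} [AddCommGroup M] (S : AddSubmonoid M) :
    AddMonoidAlgebra k S →ₐ[k] AddMonoidAlgebra k M ⊗[k] AddMonoidAlgebra k S :=
  AddMonoidAlgebra.lift k _ S
    { toFun := fun m => AddMonoidAlgebra.single (m.toAdd : M) 1 ⊗ₜ
        AddMonoidAlgebra.single m.toAdd 1
      map_one' := rfl
      map_mul' := fun a b => by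
        simp [AddMonoidAlgebra.single_mul_single] }

lemma coaction_single {M : Type u} [AddCommGroup M] (S : AddSubmonoid M) (m : S) :
    coaction k S (AddMonoidAlgebra.single m 1) =
      AddMonoidAlgebra.single (m : M) 1 ⊗ₜ AddMonoidAlgebra.single m 1 := by
  simp [coaction]

/-- The action of the torus `T_N` on the affine toric variety `U_σ`. -/
def chartAction (σ : LatticeCone N) : torus k N ⊗ affineChart k σ ⟶ affineChart k σ :=
  (specProd _ _).hom ≫ specMap (coaction k (dualMonoid σ))

lemma whiskerLeft_chartMap_chartAction {ρ σ : LatticeCone N} (h : ρ ≤ σ) :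
    torus k N ◁ chartMap k h ≫ chartAction k σ = chartAction k ρ ≫ chartMap k h := by
  rw [chartMap, chartAction, chartAction, ← Category.assoc, whiskerLeft_specProd,
    Category.assoc, Category.assoc, specMap_comp, specMap_comp]
  congr 2
  refine algHom_ext_single fun x => ?_
  simp [coaction_single, inclAlg]

/-- The action of the torus `T_N` on the toric variety of a fan in `N_ℝ`. -/
def Fan.torusAction (F : Fan N) : torus k N ⊗ F.toricVariety k ⟶ F.toricVariety k :=
  F.descTensor k (fun σ => chartAction k σ.1 ≫ F.chartι k σ) (fun ρ σ h => by
    rw [← Category.assoc, whiskerLeft_chartMap_chartAction, Category.assoc,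
      F.chartMap_chartι k h])

lemma Fan.whiskerLeft_chartι_torusAction (F : Fan N) (σ : F.cones) :
    torus k N ◁ F.chartι k σ ≫ F.torusAction k = chartAction k σ.1 ≫ F.chartι k σ :=
  F.whiskerLeft_chartι_descTensor k _ _ σ

end Torus

section Orbit

/-- The torus orbit `O_σ = Spec k[σ^⊥ ∩ M]`, i.e. the locally closed stratum of a toric variety that
corresponds to the cone `σ`. -/
def orbit (σ : LatticeCone N) : SchemeOver k := specOf (AddMonoidAlgebra k (perp σ))

open Classical in
/-- The restriction of the monomial `χ^m`, `m ∈ σ^∨ ∩ M`, to `O_σ`: it is `χ^m` if `m ∈ σ^⊥` and `0` otherwise. -/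
def orbitMonomial (σ : LatticeCone N) (m : dualMonoid σ) : AddMonoidAlgebra k (perp σ) :=
  if h : (m : CharLattice N) ∈ perp σ then AddMonoidAlgebra.single ⟨m, h⟩ 1 else 0

lemma orbitMonomial_zero (σ : LatticeCone N) : orbitMonomial k σ 0 = 1 := by
  rw [orbitMonomial, dif_pos (show ((0 : dualMonoid σ) : CharLattice N) ∈ perp σ from (perp σ).zero_mem)]
  rfl

lemma orbitMonomial_add (σ : LatticeCone N) (a b : dualMonoid σ) :
    orbitMonomial k σ (a + b) = orbitMonomial k σ a * orbitMonomial k σ b := by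
  by_cases ha : (a : CharLattice N) ∈ perp σ
  · by_cases hb : (b : CharLattice N) ∈ perp σ
    · rw [orbitMonomial, orbitMonomial, orbitMonomial, dif_pos ha, dif_pos hb,
        dif_pos (show ((a + b : dualMonoid σ) : CharLattice N) ∈ perp σ from add_mem ha hb),
        AddMonoidAlgebra.single_mul_single, one_mul]
      rfl
    · rw [orbitMonomial, orbitMonomial, orbitMonomial, dif_neg hb, mul_zero, dif_neg]
      intro hab
      exact hb (by simpa using! (perp σ).sub_mem hab ha)
  · rw [orbitMonomial, orbitMonomial, dif_neg ha, zero_mul, dif_neg]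
    intro hab
    refine ha fun x hx => ?_
    have h1 := a.2 x hx
    have h2 := b.2 x hx
    have h3 : pairing (a.1 + b.1) x = 0 := hab x hx
    rw [pairing_add] at h3
    linarith

/-- The surjection `k[σ^∨ ∩ M] → k[σ^⊥ ∩ M]` with `χ^m ↦ χ^m` for `m ∈ σ^⊥` and `χ^m ↦ 0` otherwise. -/
def orbitAlgHom (σ : LatticeCone N) :
    AddMonoidAlgebra k (dualMonoid σ) →ₐ[k] AddMonoidAlgebra k (perp σ) :=
  AddMonoidAlgebra.lift k _ _
    { toFun := fun m => orbitMonomial k σ m.toAdd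
      map_one' := orbitMonomial_zero k σ
      map_mul' := fun a b => orbitMonomial_add k σ a.toAdd b.toAdd }

/-- The closed immersion `O_σ → U_σ`. If `σ` spans `N_ℝ`, it is the torus-fixed point `0 ∈ U_σ`. -/
def orbitToChart (σ : LatticeCone N) : orbit k σ ⟶ affineChart k σ := specMap (orbitAlgHom k σ)

lemma orbitToChart_isClosedImmersion (σ : LatticeCone N) :
    IsClosedImmersion (orbitToChart k σ).left := by
  refine IsClosedImmersion.spec_of_surjective _ ?_
  intro y
  change ∃ x, orbitAlgHom k σ x = y
  induction y using AddMonoidAlgebra.induction_linear with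
  | zero => exact ⟨0, map_zero _⟩
  | add f g hf hg =>
    obtain ⟨a, rfl⟩ := hf
    obtain ⟨b, rfl⟩ := hg
    exact ⟨a + b, map_add _ _ _⟩
  | single m r =>
    refine ⟨AddMonoidAlgebra.single ⟨m.1, fun x hx => (m.2 x hx).ge⟩ r, ?_⟩
    simp [orbitAlgHom, orbitMonomial, AddMonoidAlgebra.lift_single]

/-- The inclusion of the locally closed stratum `O_σ` into the toric variety. -/
def Fan.orbitι (F : Fan N) (σ : F.cones) : orbit k σ.1 ⟶ F.toricVariety k :=
  orbitToChart k σ.1 ≫ F.chartι k σ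

end Orbit

section ToricMorphism
variable {N' : Type u} [AddCommGroup N'] (f : N →+ N')

/-- The homomorphism `χ^m ↦ χ^(m ∘ f)` for `f : N → N'` with `f(σ) ⊆ σ'`. -/
def toricChartAlgHom {σ : LatticeCone N} {σ' : LatticeCone N'}
    (h : ∀ x ∈ σ, realMap f x ∈ σ') :
    AddMonoidAlgebra k (dualMonoid σ') →ₐ[k] AddMonoidAlgebra k (dualMonoid σ) :=
  AddMonoidAlgebra.mapDomainAlgHom k k
    (((AddMonoidHom.compHom' f).comp (dualMonoid σ').subtype).codRestrict (dualMonoid σ)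
      (fun m x hx => (m.2 _ (h x hx)).trans_eq (pairing_realMap f m.1 x)))

/-- The toric morphism `U_σ → U_σ'` for `f : N → N'` with `f(σ) ⊆ σ'`. -/
def toricChartMap {σ : LatticeCone N} {σ' : LatticeCone N'}
    (h : ∀ x ∈ σ, realMap f x ∈ σ') : affineChart k σ ⟶ affineChart k σ' :=
  specMap (toricChartAlgHom k f h)

lemma chartMap_toricChartMap {ρ σ : LatticeCone N} {ρ' σ' : LatticeCone N'} (hρ : ρ ≤ σ)
    (hσ : ρ' ≤ σ') (h : ∀ x ∈ ρ, realMap f x ∈ ρ') (h' : ∀ x ∈ σ, realMap f x ∈ σ') :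
    chartMap k hρ ≫ toricChartMap k f h' = toricChartMap k f h ≫ chartMap k hσ := by
  rw [chartMap, chartMap, toricChartMap, toricChartMap, specMap_comp, specMap_comp]
  congr 1
  refine algHom_ext_single fun x => ?_
  simp [toricChartAlgHom, inclAlg]
  rfl

/-- Every cone of `F` is mapped by `f` into some cone of `F'`. -/
def Fan.Compatible (F : Fan N) (F' : Fan N') : Prop :=
  ∀ σ ∈ F.cones, ∃ σ' ∈ F'.cones, ∀ x ∈ σ, realMap f x ∈ σ'

lemma toricChartMap_chartι {F' : Fan N'} {ρ σ : LatticeCone N} (hρ : ρ ≤ σ) {ρ' σ' : F'.cones}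
    (h : ∀ x ∈ ρ, realMap f x ∈ ρ'.1) (h' : ∀ x ∈ σ, realMap f x ∈ σ'.1) :
    chartMap k hρ ≫ toricChartMap k f h' ≫ F'.chartι k σ' =
      toricChartMap k f h ≫ F'.chartι k ρ' := by
  have h0 : ∀ x ∈ ρ, realMap f x ∈ ρ'.1 ⊓ σ'.1 := fun x hx => ⟨h x hx, h' x (hρ hx)⟩
  let π' : F'.cones := ⟨ρ'.1 ⊓ σ'.1, F'.inter_mem ρ'.2 σ'.2⟩
  have h1 : π'.1 ≤ ρ'.1 := inf_le_left
  have h2 : π'.1 ≤ σ'.1 := inf_le_right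
  have e1 := chartMap_toricChartMap k f (le_refl ρ) h1 h0 h
  rw [chartMap_refl, Category.id_comp] at e1
  rw [← Category.assoc, chartMap_toricChartMap k f hρ h2 h0 h', e1, Category.assoc,
    Category.assoc, F'.chartMap_chartι k h1, F'.chartMap_chartι k h2]

variable {f} in
/-- A cone of `F'` that contains the image of `σ`. -/
def Fan.Compatible.target {F : Fan N} {F' : Fan N'} (h : F.Compatible f F') (σ : F.cones) :
    F'.cones :=
  ⟨(h σ.1 σ.2).choose, (h σ.1 σ.2).choose_spec.1⟩

variable {f} in
lemma Fan.Compatible.target_spec {F : Fan N} {F' : Fan N'} (h : F.Compatible f F')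
    (σ : F.cones) : ∀ x ∈ σ.1, realMap f x ∈ (h.target σ).1 :=
  (h σ.1 σ.2).choose_spec.2

variable {f} in
/-- The toric morphism of toric varieties given by a map of fans. On charts it is
`U_σ → U_σ' ⊆ X'` for any cone `σ'` that contains `f(σ)`. -/
def Fan.Compatible.map {F : Fan N} {F' : Fan N'} (h : F.Compatible f F') :
    F.toricVariety k ⟶ F'.toricVariety k :=
  F.desc k (fun σ => toricChartMap k f (h.target_spec σ) ≫ F'.chartι k (h.target σ))
    (fun ρ σ hρ => toricChartMap_chartι k f hρ (h.target_spec ρ) (h.target_spec σ))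

variable {f} in
lemma Fan.Compatible.chartι_map {F : Fan N} {F' : Fan N'} (h : F.Compatible f F') (σ : F.cones)
    (σ' : F'.cones) (hσ : ∀ x ∈ σ.1, realMap f x ∈ σ'.1) :
    F.chartι k σ ≫ h.map k = toricChartMap k f hσ ≫ F'.chartι k σ' := by
  rw [Fan.Compatible.map, Fan.chartι_desc, ← toricChartMap_chartι k f (le_refl _) hσ,
    chartMap_refl, Category.id_comp]

/-- The toric morphism to an affine toric variety. -/
def Fan.mapToAffine (F : Fan N) (τ : LatticeCone N')
    (h : ∀ σ ∈ F.cones, ∀ x ∈ σ, realMap f x ∈ τ) : F.toricVariety k ⟶ affineChart k τ :=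
  F.desc k (fun σ => toricChartMap k f (h σ.1 σ.2)) (fun ρ σ hρ => by
    rw [chartMap_toricChartMap k f hρ (le_refl τ) (h ρ.1 ρ.2) (h σ.1 σ.2), chartMap_refl,
      Category.comp_id])

end ToricMorphism
section Bundle

variable {k} in
/-- The action morphism `G × E → E`. -/
def actionMap (G E : SchemeOver k) [GrpObj G] [ModObj G E] : G ⊗ E ⟶ E :=
  ModObj.smul (M := G) (X := E)

/-- `p : E → B` is a principal `G`-bundle for the given action of `G` on `E`: it is invariant and,
Zariski-locally on `B`, `G`-equivariantly isomorphic to `G × U → U`. -/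
structure IsPrincipalBundle {G E B : SchemeOver k} [GrpObj G] [ModObj G E] (p : E ⟶ B) : Prop where
  invariant : actionMap G E ≫ p = snd G E ≫ p
  locallyTrivial : ∀ b : B.left, ∃ (U : SchemeOver k) (j : U ⟶ B) (t : G ⊗ U ⟶ E),
    IsOpenImmersion j.left ∧ b ∈ Set.range j.left ∧ IsPullback t (snd G U) p j ∧
      MonObj.mul (X := G) ▷ U ≫ t =
        (α_ G G U).hom ≫ G ◁ t ≫ actionMap G E

end Bundle

section Expansion
variable {L : Type u} [AddCommGroup L]

/-- A tropical expansion of the fan `Sig` over the cone `τ`: a conical subdivision `Ups` of `Sig × τ`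
(not necessarily with full support) whose projection to `τ` is integral and saturated, i.e. maps
every cone onto a face of `τ` and the lattice of the cone onto the lattice of that face. -/
structure IsTropicalExpansion (Sig : Fan N) (τ : LatticeCone L) (Ups : Fan (N × L)) : Prop where
  subdivision : ∀ ω ∈ Ups.cones, ∃ σ ∈ Sig.cones, ∀ x ∈ ω,
    realMap (AddMonoidHom.fst N L) x ∈ σ ∧ realMap (AddMonoidHom.snd N L) x ∈ τ
  integral : ∀ ω ∈ Ups.cones, IsFace (PointedCone.map (realMap (AddMonoidHom.snd N L)) ω) τ
  saturated : ∀ ω ∈ Ups.cones, (coneLattice ω).map (AddMonoidHom.snd N L) =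
    coneLattice (PointedCone.map (realMap (AddMonoidHom.snd N L)) ω)

variable {Sig : Fan N} {τ : LatticeCone L} {Ups : Fan (N × L)}

lemma IsTropicalExpansion.compatible (h : IsTropicalExpansion Sig τ Ups) :
    Ups.Compatible (AddMonoidHom.fst N L) Sig := fun ω hω => by
  obtain ⟨σ, hσ, H⟩ := h.subdivision ω hω
  exact ⟨σ, hσ, fun x hx => (H x hx).1⟩

lemma IsTropicalExpansion.snd_mem (h : IsTropicalExpansion Sig τ Ups) :
    ∀ ω ∈ Ups.cones, ∀ x ∈ ω, realMap (AddMonoidHom.snd N L) x ∈ τ := fun ω hω x hx => by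
  obtain ⟨σ, hσ, H⟩ := h.subdivision ω hω
  exact (H x hx).2

/-- The collapsing morphism `ρ : 𝒳_Υ → X`. -/
def IsTropicalExpansion.collapse (h : IsTropicalExpansion Sig τ Ups) :
    Ups.toricVariety k ⟶ Sig.toricVariety k := h.compatible.map k

/-- The family `π : 𝒳_Υ → U_τ`. -/
def IsTropicalExpansion.projection (h : IsTropicalExpansion Sig τ Ups) :
    Ups.toricVariety k ⟶ affineChart k τ :=
  Ups.mapToAffine k (AddMonoidHom.snd N L) τ h.snd_mem

/-- The rubber action of `T_τ` on `𝒳_Υ`, through the inclusion `T_τ → T_Σ × T_τ` of the second factor. -/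
def rubberAction (Ups : Fan (N × L)) : torus k L ⊗ Ups.toricVariety k ⟶ Ups.toricVariety k :=
  torusMap k (AddMonoidHom.inr N L) ▷ Ups.toricVariety k ≫ Ups.torusAction k

/-- The polyhedron `P = ω ∩ p⁻¹(f)` in the fibre over `f`, viewed in `N_ℝ`. -/
def polyhedron (ω : LatticeCone (N × L)) (f : RealSpace L) : Set (RealSpace N) :=
  {x | ∃ z ∈ ω, realMap (AddMonoidHom.fst N L) z = x ∧ realMap (AddMonoidHom.snd N L) z = f}

/-- The lattice `K_P = ker(N_ω → N_τ)` of directions of `P`, viewed in `N`. -/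
def directionLattice (ω : LatticeCone (N × L)) : AddSubgroup N :=
  (coneLattice ω).comap (AddMonoidHom.inl N L)

/-- The lattice `N_θ = N_σ / K_P`. -/
abbrev ThetaLattice (ω : LatticeCone (N × L)) (σ : LatticeCone N) : Type u :=
  coneLattice σ ⧸ (directionLattice ω).addSubgroupOf (coneLattice σ)

/-- The projection `N_σ → N_θ`. -/
def thetaProj (ω : LatticeCone (N × L)) (σ : LatticeCone N) :
    coneLattice σ →+ ThetaLattice ω σ :=
  QuotientAddGroup.mk' _

/-- The cone `σ`, viewed in `N_σ ⊗ ℝ`. -/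
def coneInLattice (σ : LatticeCone N) : LatticeCone (coneLattice σ) :=
  PointedCone.comap (realMap (coneLattice σ).subtype) σ

/-- The cone `θ_P`, the image of `σ` in `N_θ ⊗ ℝ`. -/
def thetaCone (ω : LatticeCone (N × L)) (σ : LatticeCone N) : LatticeCone (ThetaLattice ω σ) :=
  PointedCone.map (realMap (thetaProj ω σ)) (coneInLattice σ)

/-- `φ` records the position of the polyhedron `P = P_f` for every `f ∈ τ`: all the points of `P_f` lie in
`σ` and have image `φ(f)` in `θ_P`. -/
def IsPositionMap (τ : LatticeCone L) (ω : LatticeCone (N × L)) (σ : LatticeCone N)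
    (φ : L →+ ThetaLattice ω σ) : Prop :=
  ∀ f ∈ τ, ∀ x ∈ polyhedron ω f, ∃ y ∈ coneInLattice σ,
    realMap (coneLattice σ).subtype y = x ∧ realMap (thetaProj ω σ) y = realMap φ f

end Expansion
end Variety

end Toric

end

open CategoryTheory AlgebraicGeometry MonoidalCategory CartesianMonoidalCategory Toric

/-! Every stratum is itself a group: the orbit `O_σ = Spec k[σ^⊥ ∩ M]` is the quotient of `T_N` with
character group `σ^⊥`, and `T_N` acts on it by translation through this quotient
(`torusToOrbit_mul_orbitToChart`). So all claims about strata become statements about homomorphisms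
of character groups, transported by the contravariant `diagMap`, which is compatible with
composition and turns sums of homomorphisms into pointwise products of morphisms.

The stratum of `ω` maps to the stratum of `σ` because `σ` is the smallest cone containing the image
of `ω`: a character in `σ^∨` that vanishes on this image cuts out a face of `σ` containing it, hence
all of `σ`. Thus a monomial that vanishes on `O_σ` pulls back to one that vanishes on `O_ω`
(`Fan.mem_perp_of_isLeast`, `orbitMap_orbitToChart`). For `τ` the same condition holds because `ω`
surjects onto it.

The bundle comes from the sequence `0 → σ^⊥ → ω^⊥ → Hom(N_θ, ℤ) → 0`, in which the first map is `m ↦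
m ∘ pr₁` and the second restricts a character to `N_σ × 0` with the opposite sign. Since `N_σ` is
saturated it is a direct summand of `N`, and a retraction `N → N_σ` splits the sequence
(`IsPositionHom.exists_splitting`). Dually `O_ω ≅ T_θ × O_σ`, so the bundle is even globally trivial
(`isPrincipalBundle_of_split`).

The position map sends `l` to the class of `n` for any `(n, l) ∈ N_ω`. Saturatedness of the
expansion provides such an `n`, and two choices differ by an element of `K_P`. A character `m ∈ ω^⊥`
satisfies `m(n, l) = 0`, so `m(0, l) = -m(n, 0)`: this identity (`IsPositionHom.thetaChar_apply`) is
the statement that the rubber action factors through `φ`, and it is the reason why the structure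
group acts with an inverse. -/

noncomputable section
open CategoryTheory AlgebraicGeometry Limits MonoidalCategory CartesianMonoidalCategory Opposite
open scoped TensorProduct MonObj

namespace Toric

/-! ### Diagonalizable groups and the duality with abelian groups -/

section Diagonalizable
variable {k : Type u} [Field k]

lemma mul_specOf (A : Type u) [CommRing A] [HopfAlgebra k A] :
    MonObj.mul (X := specOf (k := k) A) =
      (specProd A A).hom ≫ specMap (Bialgebra.comulAlgHom k A) := by
  ext : 1
  rfl

lemma one_specOf_left (A : Type u) [CommRing A] [HopfAlgebra k A] :
    (MonObj.one (X := specOf (k := k) A)).left =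
      Spec.map (CommRingCat.ofHom (Bialgebra.counitAlgHom k A).toRingHom) :=
  rfl

lemma specMap_tensor_specMap {A B A' B' : Type u} [CommRing A] [CommRing B] [CommRing A']
    [CommRing B'] [Algebra k A] [Algebra k B] [Algebra k A'] [Algebra k B']
    (f : A →ₐ[k] A') (g : B →ₐ[k] B') :
    (specMap f ⊗ₘ specMap g) ≫ (specProd A B).hom = (specProd A' B').hom ≫
      specMap (Algebra.TensorProduct.map f g) := by
  rw [← Iso.eq_comp_inv, Category.assoc, ← Iso.inv_comp_eq]
  apply CartesianMonoidalCategory.hom_ext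
  · simp only [Category.assoc, tensorHom_fst, specProd_inv_fst, specMap_comp]
    rw [← Category.assoc, specProd_inv_fst, specMap_comp]
    congr 1
    ext : 1; simp
  · simp only [Category.assoc, tensorHom_snd, specProd_inv_snd, specMap_comp]
    rw [← Category.assoc, specProd_inv_snd, specMap_comp]
    congr 1
    ext : 1; simp

/-- Compatibility with counit and comultiplication is exactly compatibility of the dual morphism
with unit and multiplication. -/
lemma isMonHom_specMap {A B : Type u} [CommRing A] [CommRing B] [HopfAlgebra k A]
    [HopfAlgebra k B] (f : A →ₐc[k] B) : IsMonHom (specMap (k := k) (f : A →ₐ[k] B)) where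
  one_hom := by
    ext : 1
    refine (Spec.map_comp (CommRingCat.ofHom (f : A →ₐ[k] B).toRingHom)
      (CommRingCat.ofHom (Bialgebra.counitAlgHom k B).toRingHom)).symm.trans ?_
    rw [← CommRingCat.ofHom_comp, one_specOf_left]
    congr 2
    ext x
    simp
  mul_hom := by
    rw [mul_specOf, mul_specOf, ← Category.assoc, specMap_tensor_specMap, Category.assoc,
      Category.assoc, specMap_comp, specMap_comp]
    congr 2
    ext x
    simp

variable (k) in
/-- The morphism `Spec k[B] → Spec k[A]` of diagonalizable groups that is dual to `f : A → B`. -/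
def diagMap {A B : Type u} [AddCommGroup A] [AddCommGroup B] (f : A →+ B) :
    specOf (k := k) (AddMonoidAlgebra k B) ⟶ specOf (AddMonoidAlgebra k A) :=
  specMap (AddMonoidAlgebra.mapDomainAlgHom k k f)

variable {A B C : Type u} [AddCommGroup A] [AddCommGroup B] [AddCommGroup C]

instance isMonHom_diagMap (f : A →+ B) : IsMonHom (diagMap k f) :=
  isMonHom_specMap (AddMonoidAlgebra.mapDomainBialgHom k f)

lemma diagMap_comp (f : A →+ B) (g : B →+ C) :
    diagMap k g ≫ diagMap k f = diagMap k (g.comp f) := by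
  rw [diagMap, diagMap, specMap_comp, diagMap]
  congr 1
  refine algHom_ext_single fun x => ?_
  simp

lemma diagMap_id : diagMap k (AddMonoidHom.id A) = 𝟙 _ := by
  rw [diagMap, ← specMap_id]
  congr 1
  refine algHom_ext_single fun x => ?_
  simp

lemma specMap_mul_specMap {S T : Type u} [CommRing S] [CommRing T] [HopfAlgebra k S] [Algebra k T]
    (f g : S →ₐ[k] T) :
    specMap f * specMap g = specMap
      ((Algebra.TensorProduct.lift f g fun _ _ => .all _ _).comp (Bialgebra.comulAlgHom k S)) := by
  rw [Hom.mul_def, mul_specOf, ← specMap_comp, ← Category.assoc]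
  congr 1
  rw [← Iso.eq_comp_inv]
  apply CartesianMonoidalCategory.hom_ext
  · rw [lift_fst, Category.assoc, specProd_inv_fst, specMap_comp]
    congr 1
    ext : 1; simp
  · rw [lift_snd, Category.assoc, specProd_inv_snd, specMap_comp]
    congr 1
    ext : 1; simp

/-- The elements `χ^a` are group-like, so the pointwise product of the two morphisms pulls `χ^a`
back to `χ^(f a) χ^(g a) = χ^((f + g) a)`. -/
lemma diagMap_mul (f g : A →+ B) : diagMap k f * diagMap k g = diagMap k (f + g) := by
  rw [diagMap, diagMap, specMap_mul_specMap, diagMap]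
  congr 1
  refine algHom_ext_single fun x => ?_
  simp [AddMonoidAlgebra.single_mul_single]

lemma diagMap_zero : diagMap k (0 : A →+ B) = 1 := by
  have h := diagMap_mul (k := k) (0 : A →+ B) 0
  rw [add_zero] at h
  -- An idempotent in the group of morphisms is the identity.
  exact mul_eq_left.1 h

end Diagonalizable

/-! ### Translation actions and split extensions of group schemes -/

section Translation
variable {C : Type*} [Category C] [CartesianMonoidalCategory C]

/-- The action of `G` on `E` by left translation through a homomorphism `i : G → E`. -/
@[reducible]
def translationAction {G E : C} [MonObj G] [MonObj E] (i : G ⟶ E) [IsMonHom i] : ModObj G E :=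
  letI := ModObj.regular E
  Mod.scalarRestriction i E

end Translation

section Split
variable {k : Type u} [Field k] {G E B : SchemeOver k} [GrpObj G] [GrpObj E] [GrpObj B]
  (i : G ⟶ E) [IsMonHom i] (p : E ⟶ B) [IsMonHom p]

/-- A split exact sequence of groups `1 → G → E → B → 1` makes `E` a (trivial) principal `G`-bundle
over `B`. -/
lemma isPrincipalBundle_of_split (hip : i ≫ p = 1) (q : E ⟶ G) [IsMonHom q] (s : B ⟶ E)
    [IsMonHom s] (hiq : i ≫ q = 𝟙 G) (hsp : s ≫ p = 𝟙 B) (hsq : s ≫ q = 1)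
    (h : (q ≫ i) * (p ≫ s) = 𝟙 E) :
    let := translationAction i
    IsPrincipalBundle k (G := G) p := by
  let := translationAction i
  -- On points, `g` acts on `e` as `i(g) e`; from here on everything is computed in groups of
  -- morphisms.
  have hact : actionMap G E = (fst G E ≫ i) * snd G E := by
    change i ▷ E ≫ μ[E] = _
    rw [Hom.mul_def]
    congr 1
  -- The global trivialization `(g, b) ↦ i(g) s(b)`, with inverse `(q, p)`. A single chart `U = B`
  -- therefore serves for every point.
  let t : G ⊗ B ⟶ E := (fst G B ≫ i) * (snd G B ≫ s)
  have ht : t = (fst G B ≫ i) * (snd G B ≫ s) := rfl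
  have htp : t ≫ p = snd G B := by
    rw [ht, MonObj.mul_comp, Category.assoc, Category.assoc, hip, hsp, MonObj.comp_one, one_mul,
      Category.comp_id]
  have htq : t ≫ q = fst G B := by
    rw [ht, MonObj.mul_comp, Category.assoc, Category.assoc, hiq, hsq, MonObj.comp_one, mul_one,
      Category.comp_id]
  refine ⟨?_, fun b => ⟨B, 𝟙 B, t, ?_, ⟨b, rfl⟩, ?_, ?_⟩⟩
  · rw [hact, MonObj.mul_comp, Category.assoc, hip, MonObj.comp_one, one_mul]
  · change IsOpenImmersion (𝟙 B.left)
    infer_instance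
  · have : IsIso t := by
      refine ⟨lift q p, ?_, ?_⟩
      · apply CartesianMonoidalCategory.hom_ext <;> simp [htp, htq]
      · rw [ht, MonObj.comp_mul, ← Category.assoc, ← Category.assoc, lift_fst, lift_snd, h]
    exact IsPullback.of_horiz_isIso ⟨by rw [htp, Category.comp_id]⟩
  -- Equivariance is `i(g g') s(b) = i(g) (i(g') s(b))`, that is, associativity and multiplicativity
  -- of `i`.
  · rw [hact, MonObj.comp_mul, MonObj.comp_mul, ht, MonObj.comp_mul]
    simp only [whiskerLeft_fst_assoc, whiskerLeft_snd, whiskerRight_fst_assoc,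
      whiskerRight_snd_assoc, MonObj.comp_mul, associator_hom_fst_assoc,
      associator_hom_snd_fst_assoc, associator_hom_snd_snd_assoc]
    rw [← mul_assoc]
    congr 1
    rw [MonObj.mul_eq_mul, MonObj.mul_comp, MonObj.comp_mul]

end Split

/-! ### Torus orbits as quotient tori -/

section OrbitAction
variable {k : Type u} [Field k] {N N' : Type u} [AddCommGroup N] [AddCommGroup N']

/-- The orbit `O_σ` is the quotient torus of `T_N` with character group `σ^⊥ ∩ M`. -/
instance (σ : LatticeCone N) : GrpObj (orbit k σ) :=
  inferInstanceAs (GrpObj (specOf (AddMonoidAlgebra k (perp σ))))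

lemma orbitAlgHom_single (σ : LatticeCone N) (m : dualMonoid σ) :
    orbitAlgHom k σ (AddMonoidAlgebra.single m 1) = orbitMonomial k σ m := by
  simp [orbitAlgHom]

variable (k) in
/-- The quotient homomorphism `T_N → O_σ`. -/
def torusToOrbit (σ : LatticeCone N) : torus k N ⟶ orbit k σ := diagMap k (perp σ).subtype

/-- Both composites send `χ^m` to `χ^m ⊗ χ^m` if `m ∈ σ^⊥` and to `0` otherwise. So the torus action
preserves the stratum and is translation there. -/
lemma torusToOrbit_mul_orbitToChart (σ : LatticeCone N) :
    torusToOrbit k σ ▷ orbit k σ ≫ μ[orbit k σ] ≫ orbitToChart k σ =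
      torus k N ◁ orbitToChart k σ ≫ chartAction k σ := by
  change specMap (AddMonoidAlgebra.mapDomainAlgHom k k (perp σ).subtype) ▷
      specOf (AddMonoidAlgebra k (perp σ)) ≫ μ[specOf (k := k) (AddMonoidAlgebra k (perp σ))] ≫
        specMap (orbitAlgHom k σ) =
    specOf (AddMonoidAlgebra k (CharLattice N)) ◁ specMap (orbitAlgHom k σ) ≫
      (specProd _ _).hom ≫ specMap (coaction k (dualMonoid σ))
  have h₁ := specMap_tensor_specMap (AddMonoidAlgebra.mapDomainAlgHom k k (perp σ).subtype)
    (AlgHom.id k (AddMonoidAlgebra k (perp σ)))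
  have h₂ := whiskerLeft_specProd (C := AddMonoidAlgebra k (CharLattice N)) (orbitAlgHom k σ)
  rw [mul_specOf, ← tensorHom_id, ← specMap_id, Category.assoc, specMap_comp, reassoc_of% h₁,
    reassoc_of% h₂, specMap_comp, specMap_comp]
  congr 2
  refine algHom_ext_single fun m => ?_
  simp only [AlgHom.comp_apply, coaction_single, orbitAlgHom_single,
    Algebra.TensorProduct.map_tmul, AlgHom.id_apply]
  by_cases hm : m.1 ∈ perp σ
  · rw [orbitMonomial, dif_pos hm]
    simp
  · rw [orbitMonomial, dif_neg hm, map_zero, map_zero, TensorProduct.tmul_zero]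

/-- An arbitrary source `T` is allowed so that the same formula serves the torus of `N_σ` and the
rubber torus. -/
lemma Fan.tensor_orbitι_torusAction (F : Fan N) (σ : F.cones) {T : SchemeOver k}
    (a : T ⟶ torus k N) :
    (a ⊗ₘ F.orbitι k σ) ≫ F.torusAction k =
      (a ≫ torusToOrbit k σ.1) ▷ orbit k σ.1 ≫ μ[orbit k σ.1] ≫ F.orbitι k σ := by
  have h := torusToOrbit_mul_orbitToChart (k := k) σ.1
  rw [Fan.orbitι, comp_whiskerRight, Category.assoc, reassoc_of% h,
    ← F.whiskerLeft_chartι_torusAction k, ← MonoidalCategory.whiskerLeft_comp_assoc,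
    MonoidalCategory.tensorHom_def, Category.assoc]

/-- The pullback of characters `σ'^⊥ → σ^⊥` along `f : N → N'` with `f(σ) ⊆ σ'`. -/
def perpPullback (f : N →+ N') {σ : LatticeCone N} {σ' : LatticeCone N'}
    (h : ∀ x ∈ σ, realMap f x ∈ σ') : perp σ' →+ perp σ :=
  ((AddMonoidHom.compHom' f).comp (perp σ').subtype).codRestrict (perp σ)
    fun m x hx => (pairing_realMap f m.1 x).symm.trans (m.2 _ (h x hx))

variable (k) in
/-- The morphism of orbits `O_σ → O_σ'` for `f : N → N'` with `f(σ) ⊆ σ'`. -/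
def orbitMap (f : N →+ N') {σ : LatticeCone N} {σ' : LatticeCone N'}
    (h : ∀ x ∈ σ, realMap f x ∈ σ') : orbit k σ ⟶ orbit k σ' :=
  diagMap k (perpPullback f h)

/-- If `f(σ)` is not contained in a proper face of `σ'`, then `O_σ` is mapped to `O_σ'`. -/
lemma orbitMap_orbitToChart (f : N →+ N') {σ : LatticeCone N} {σ' : LatticeCone N'}
    (h : ∀ x ∈ σ, realMap f x ∈ σ')
    (H : ∀ m ∈ dualMonoid σ', m.comp f ∈ perp σ → m ∈ perp σ') :
    orbitMap k f h ≫ orbitToChart k σ' = orbitToChart k σ ≫ toricChartMap k f h := by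
  refine (specMap_comp _ _).trans (Eq.trans ?_ (specMap_comp _ _).symm)
  congr 1
  refine algHom_ext_single fun m => ?_
  have e : toricChartAlgHom k f h (AddMonoidAlgebra.single m 1) = AddMonoidAlgebra.single
      ⟨m.1.comp f, fun x hx => (m.2 _ (h x hx)).trans_eq (pairing_realMap f m.1 x)⟩ 1 := by
    simp [toricChartAlgHom]
    rfl
  simp only [AlgHom.comp_apply, e, orbitAlgHom_single]
  -- The hypothesis `H` makes the monomials that die on the two sides the same ones.
  by_cases hm : m.1 ∈ perp σ'
  · have hm' : m.1.comp f ∈ perp σ := (perpPullback f h ⟨m.1, hm⟩).2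
    rw [orbitMonomial, dif_pos hm, orbitMonomial, dif_pos hm']
    simp
    rfl
  · have hm' : m.1.comp f ∉ perp σ := fun h' => hm (H _ m.2 h')
    rw [orbitMonomial, dif_neg hm, orbitMonomial, dif_neg hm', map_zero]

end OrbitAction

/-! ### The lattice of a cone: saturation, perpendicular characters, retraction -/

section ConeLattice
variable {N N' : Type u} [AddCommGroup N] [AddCommGroup N']

lemma realMap_latticePoint (f : N →+ N') (n : N) :
    realMap f (latticePoint n) = latticePoint (f n) := by
  simp [realMap, latticePoint]

/-- This is flatness of `ℝ` over `ℤ`. -/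
lemma realMap_injective {f : N →+ N'} (hf : Function.Injective f) :
    Function.Injective (realMap f) :=
  Module.Flat.lTensor_preserves_injective_linearMap (M := ℝ) f.toIntLinearMap hf

/-- Integral characters separate the points of a free lattice, and they are still visible after
tensoring with `ℝ`. -/
lemma latticePoint_injective [Module.Free ℤ N] : Function.Injective (latticePoint (N := N)) :=
  fun a b hab => by
  refine sub_eq_zero.1 ((Module.forall_dual_apply_eq_zero_iff ℤ (a - b)).1 fun m => ?_)
  have h := congrArg (pairing m.toAddMonoidHom) hab
  rw [pairing_latticePoint, pairing_latticePoint, Int.cast_inj] at h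
  rw [map_sub]
  exact sub_eq_zero.2 h

/-- A real subspace is stable under division by `a`. This saturation is what makes `N / N_σ` and
`N_σ / K_P` torsion-free. -/
lemma zsmul_mem_coneLattice_iff {σ : LatticeCone N} {a : ℤ} (ha : a ≠ 0) {n : N} :
    a • n ∈ coneLattice σ ↔ n ∈ coneLattice σ := by
  refine ⟨fun h => ?_, fun h => zsmul_mem h a⟩
  have e : latticePoint (a • n) = (a : ℝ) • latticePoint n := by
    rw [latticePoint, TensorProduct.tmul_smul, ← Int.cast_smul_eq_zsmul ℝ]; rfl
  have h' : latticePoint (a • n) ∈ Submodule.span ℝ (σ : Set (RealSpace N)) := h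
  rw [e] at h'
  exact (Submodule.smul_mem_iff _ (Int.cast_ne_zero.2 ha)).1 h'

lemma pairing_eq_zero_of_mem_span {σ : LatticeCone N} {m : CharLattice N} (hm : m ∈ perp σ)
    {x : RealSpace N} (hx : x ∈ Submodule.span ℝ (σ : Set (RealSpace N))) : pairing m x = 0 := by
  have : Submodule.span ℝ (σ : Set (RealSpace N)) ≤ LinearMap.ker (pairing m) :=
    Submodule.span_le.2 fun y hy => hm y hy
  exact this hx

lemma apply_eq_zero_of_mem_coneLattice {σ : LatticeCone N} {m : CharLattice N} (hm : m ∈ perp σ)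
    {n : N} (hn : n ∈ coneLattice σ) : m n = 0 := by
  have h := pairing_eq_zero_of_mem_span hm (x := latticePoint n) hn
  rw [pairing_latticePoint] at h
  exact_mod_cast h

/-- Induction on points of a rational cone: a linear condition holds on `σ` if it holds at the
lattice points of `σ`. -/
lemma IsRationalPolyhedral.induction {σ : LatticeCone N} (hσ : IsRationalPolyhedral σ)
    {P : RealSpace N → Prop} (zero : P 0) (add : ∀ x y, P x → P y → P (x + y))
    (smul : ∀ (a : ℝ) x, P x → P (a • x)) (point : ∀ n, latticePoint n ∈ σ → P (latticePoint n))
    {x : RealSpace N} (hx : x ∈ σ) : P x := by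
  obtain ⟨s, rfl⟩ := hσ
  induction hx using Submodule.span_induction with
  | mem x h =>
    obtain ⟨v, hv, rfl⟩ := h
    exact point v (Submodule.subset_span ⟨v, hv, rfl⟩)
  | zero => exact zero
  | add x y _ _ hx hy => exact add x y hx hy
  | smul a x _ hx => exact smul (a : ℝ) x hx

lemma mem_coneLattice_of_mem {σ : LatticeCone N} {n : N} (hn : latticePoint n ∈ σ) :
    n ∈ coneLattice σ := Submodule.subset_span hn

/-- A rational cone is generated by lattice points, all of which lie in `N_σ`, so vanishing on `N_σ`
can be tested in place of vanishing on `σ`. -/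
lemma mem_perp_of_coneLattice {σ : LatticeCone N} (hσ : IsRationalPolyhedral σ)
    {m : CharLattice N} (hm : ∀ n ∈ coneLattice σ, m n = 0) : m ∈ perp σ := fun _ hx =>
  hσ.induction (P := fun x => pairing m x = 0) (map_zero _)
    (fun x y hx hy => by rw [map_add, hx, hy, add_zero])
    (fun a x hx => by rw [map_smul, hx, smul_zero])
    (fun n hn => by
      rw [pairing_latticePoint, hm n (mem_coneLattice_of_mem hn), Int.cast_zero]) hx

lemma map_mem_coneLattice {f : N →+ N'} {σ : LatticeCone N} {σ' : LatticeCone N'}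
    (h : ∀ x ∈ σ, realMap f x ∈ σ') {n : N} (hn : n ∈ coneLattice σ) : f n ∈ coneLattice σ' := by
  have : Submodule.span ℝ (σ : Set (RealSpace N)) ≤
      (Submodule.span ℝ (σ' : Set (RealSpace N'))).comap (realMap f) :=
    Submodule.span_le.2 fun y hy => Submodule.subset_span (h y hy)
  have h' := this hn
  rwa [Submodule.mem_comap, realMap_latticePoint] at h'

lemma coneLattice_eq_top {σ : LatticeCone N}
    (hσ : Submodule.span ℝ (σ : Set (RealSpace N)) = ⊤) : coneLattice σ = ⊤ := by
  refine eq_top_iff.2 fun n _ => ?_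
  change latticePoint n ∈ Submodule.span ℝ (σ : Set (RealSpace N))
  rw [hσ]
  trivial

/-- `N_σ` is a direct summand of `N`. -/
lemma exists_retraction_coneLattice [Module.Finite ℤ N] (σ : LatticeCone N) :
    ∃ r : N →+ coneLattice σ, ∀ n (hn : n ∈ coneLattice σ), r n = ⟨n, hn⟩ := by
  let S : Submodule ℤ N := AddSubgroup.toIntSubmodule (coneLattice σ)
  -- Torsion-freeness gives freeness of `N / N_σ`, hence a section `s` of the quotient map; `n ↦ n -
  -- s [n]` is then the retraction.
  have htf : Module.IsTorsionFree ℤ (N ⧸ S) := by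
    refine Module.IsTorsionFree.of_smul_eq_zero fun a x hax => ?_
    obtain ⟨n, rfl⟩ := S.mkQ_surjective x
    rw [← map_smul] at hax
    refine or_iff_not_imp_left.2 fun ha => (Submodule.Quotient.mk_eq_zero S).2 ?_
    exact (zsmul_mem_coneLattice_iff ha).1 ((Submodule.Quotient.mk_eq_zero S).1 hax)
  have : Module.Free ℤ (N ⧸ S) := Module.free_of_finite_type_torsion_free'
  obtain ⟨s, hs⟩ := Module.projective_lifting_property S.mkQ LinearMap.id S.mkQ_surjective
  have hr : ∀ n, n - s (S.mkQ n) ∈ coneLattice σ := fun n => by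
    have h : S.mkQ (n - s (S.mkQ n)) = 0 := by
      rw [map_sub, ← LinearMap.comp_apply S.mkQ s, hs, LinearMap.id_apply, sub_self]
    exact (Submodule.Quotient.mk_eq_zero S).1 h
  refine ⟨(AddMonoidHom.id N - (s.comp S.mkQ).toAddMonoidHom).codRestrict _ hr, fun n hn => ?_⟩
  ext
  have h : S.mkQ n = 0 := (Submodule.Quotient.mk_eq_zero S).2 hn
  change n - s (S.mkQ n) = n
  rw [h, map_zero, sub_zero]

end ConeLattice

/-! ### The smallest cone of a fan containing a set -/

section SmallestCone
variable {N : Type u} [AddCommGroup N]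

/-- The character that cuts out the face `ρ` vanishes on the span of `ρ`, hence on all of `σ`. -/
lemma eq_of_isFace_of_span_le {ρ σ : LatticeCone N} (h : IsFace ρ σ)
    (hs : (σ : Set (RealSpace N)) ⊆ Submodule.span ℝ (ρ : Set (RealSpace N))) : ρ = σ := by
  obtain ⟨m, -, hρ⟩ := h
  ext x
  refine (hρ x).trans ⟨And.left, fun hx => ⟨hx, ?_⟩⟩
  exact pairing_eq_zero_of_mem_span (m := m) (fun y hy => ((hρ y).1 hy).2) (hs hx)

/-- Among the cones of a fan that contain a given set there is a smallest one. -/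
lemma Fan.exists_isLeast [Module.Finite ℤ N] (F : Fan N) (A : Set (RealSpace N))
    (hA : ∃ σ ∈ F.cones, A ⊆ σ) : ∃ σ : F.cones, IsLeast {ρ : F.cones | A ⊆ ρ.1} σ := by
  -- The fan may be infinite, so minimality is taken with respect to the linear span, where finite
  -- dimension gives well-foundedness.
  obtain ⟨σ, hσ, hmin⟩ := WellFounded.has_min (InvImage.wf (fun ρ : F.cones =>
    Submodule.span ℝ (ρ.1 : Set (RealSpace N))) wellFounded_lt) {ρ : F.cones | A ⊆ ρ.1}
    (let ⟨σ, hσ, h⟩ := hA; ⟨⟨σ, hσ⟩, h⟩)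
  refine ⟨σ, hσ, fun ρ hρ => ?_⟩
  let π : F.cones := ⟨σ.1 ⊓ ρ.1, F.inter_mem σ.2 ρ.2⟩
  have hle : Submodule.span ℝ (π.1 : Set (RealSpace N)) ≤
      Submodule.span ℝ (σ.1 : Set (RealSpace N)) := Submodule.span_mono fun x hx => hx.1
  -- The intersection with a competitor `ρ` also contains `A`, so its span cannot be smaller; a face
  -- of `σ` with the same span is `σ`.
  have heq := (eq_or_lt_of_le hle).resolve_right (hmin π fun x hx => ⟨hσ hx, hρ hx⟩)
  have h : π.1 = σ.1 := eq_of_isFace_of_span_le (F.inter_face _ σ.2 _ ρ.2)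
    (heq ▸ Submodule.subset_span)
  exact inf_eq_left.1 h

/-- A set whose smallest cone is `σ` is not contained in a proper face of `σ`. -/
lemma Fan.mem_perp_of_isLeast (F : Fan N) {A : Set (RealSpace N)} {σ : F.cones}
    (hσ : IsLeast {ρ : F.cones | A ⊆ ρ.1} σ) {m : CharLattice N} (hm : m ∈ dualMonoid σ.1)
    (hA : ∀ x ∈ A, pairing m x = 0) : m ∈ perp σ.1 := by
  -- The face of `σ` cut out by `m` contains `A`, so by leastness it contains `σ`.
  let ρ : LatticeCone N := σ.1 ⊓ (LinearMap.ker (pairing m)).restrictScalars _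
  have hρ : ∀ x, x ∈ ρ ↔ x ∈ σ.1 ∧ pairing m x = 0 := fun x => Iff.rfl
  have hle : σ ≤ ⟨ρ, F.face_mem _ σ.2 ρ ⟨m, hm, hρ⟩⟩ := hσ.2 fun x hx => ⟨hσ.1 hx, hA x hx⟩
  exact fun x hx => ((hρ x).1 (hle hx)).2

end SmallestCone

/-! ### The lattice `N_θ` and its characters -/

section Theta
variable {N L : Type u} [AddCommGroup N] [AddCommGroup L] {ω : LatticeCone (N × L)}
  {σ : LatticeCone N}

lemma thetaProj_surjective : Function.Surjective (thetaProj ω σ) :=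
  QuotientAddGroup.mk'_surjective _

lemma thetaProj_eq_zero_iff {x : coneLattice σ} :
    thetaProj ω σ x = 0 ↔ ((x : N), (0 : L)) ∈ coneLattice ω :=
  QuotientAddGroup.eq_zero_iff x

/-- `K_P` inherits saturation from `N_ω`, so the quotient is finitely generated and torsion-free. -/
lemma free_thetaLattice [Module.Finite ℤ N] : Module.Free ℤ (ThetaLattice ω σ) := by
  have : Module.Finite ℤ (coneLattice σ) :=
    inferInstanceAs (Module.Finite ℤ (AddSubgroup.toIntSubmodule (coneLattice σ)))
  have : Module.Finite ℤ (ThetaLattice ω σ) :=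
    Module.Finite.of_surjective (thetaProj ω σ).toIntLinearMap thetaProj_surjective
  have : Module.IsTorsionFree ℤ (ThetaLattice ω σ) := by
    refine Module.IsTorsionFree.of_smul_eq_zero fun a x hax => or_iff_not_imp_left.2 fun ha => ?_
    obtain ⟨n, rfl⟩ := thetaProj_surjective x
    rw [← map_zsmul, thetaProj_eq_zero_iff] at hax
    refine thetaProj_eq_zero_iff.2 ((zsmul_mem_coneLattice_iff ha).1 ?_)
    simpa using hax
  exact Module.free_of_finite_type_torsion_free'

/-- The restriction of a character in `ω^⊥` to `N_σ × 0`, with the opposite sign, viewed as a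
character of `N_θ = N_σ / K`. -/
def thetaChar (ω : LatticeCone (N × L)) (σ : LatticeCone N) :
    perp ω →+ CharLattice (ThetaLattice ω σ) where
  toFun m := QuotientAddGroup.lift _
    (-(m.1.comp ((AddMonoidHom.inl N L).comp (coneLattice σ).subtype))) fun _ hx =>
      neg_eq_zero.2 (apply_eq_zero_of_mem_coneLattice m.2 hx)
  map_zero' := by
    refine QuotientAddGroup.addMonoidHom_ext _ (AddMonoidHom.ext fun x => ?_)
    exact neg_zero
  map_add' m m' := by
    refine QuotientAddGroup.addMonoidHom_ext _ (AddMonoidHom.ext fun x => ?_)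
    exact neg_add _ _

lemma thetaChar_thetaProj (m : perp ω) (x : coneLattice σ) :
    thetaChar ω σ m (thetaProj ω σ x) = -m.1 (x, 0) := rfl

/-! ### The tropical position map -/

section Position

/-- `φ` sends `l` to the class of `n` for every `(n, l) ∈ N_ω` with `n ∈ N_σ`. -/
def IsPositionHom (φ : L →+ ThetaLattice ω σ) : Prop :=
  ∀ n l, (n, l) ∈ coneLattice ω → ∀ hn : n ∈ coneLattice σ, φ l = thetaProj ω σ ⟨n, hn⟩

/-- If `N_ω` projects onto `L`, then sending `l` to the class of `n` for `(n, l) ∈ N_ω` is a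
well-defined map `L → N_θ`. -/
lemma exists_isPositionHom (hr : ∀ x ∈ ω, realMap (AddMonoidHom.fst N L) x ∈ σ)
    (hs : (coneLattice ω).map (AddMonoidHom.snd N L) = ⊤) :
    ∃ φ : L →+ ThetaLattice ω σ, IsPositionHom φ := by
  let s : coneLattice ω →+ L := (AddMonoidHom.snd N L).comp (coneLattice ω).subtype
  have hsurj : Function.Surjective s := fun l => by
    obtain ⟨x, hx, rfl⟩ : l ∈ (coneLattice ω).map (AddMonoidHom.snd N L) := hs ▸ trivial
    exact ⟨⟨x, hx⟩, rfl⟩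
  let g : coneLattice ω →+ ThetaLattice ω σ := (thetaProj ω σ).comp
    (((AddMonoidHom.fst N L).comp (coneLattice ω).subtype).codRestrict (coneLattice σ)
      fun x => map_mem_coneLattice hr x.2)
  have hker : s.ker ≤ g.ker := by
    -- An element `(n, 0)` of `N_ω` has `n ∈ K_P`, so its class in `N_θ` vanishes.
    rintro ⟨⟨n, l⟩, h⟩ (rfl : l = 0)
    exact thetaProj_eq_zero_iff.2 h
  refine ⟨s.liftOfSurjective hsurj ⟨g, hker⟩, fun n l h hn => ?_⟩
  exact s.liftOfRightInverse_comp_apply _ _ ⟨g, hker⟩ ⟨(n, l), h⟩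

variable {φ : L →+ ThetaLattice ω σ}

lemma IsPositionHom.exists_mem_coneInLattice (hφ : IsPositionHom φ)
    (hr : ∀ x ∈ ω, realMap (AddMonoidHom.fst N L) x ∈ σ) (hω : IsRationalPolyhedral ω) {z : RealSpace (N × L)} (hz : z ∈ ω) :
    ∃ y ∈ coneInLattice σ,
      realMap (coneLattice σ).subtype y = realMap (AddMonoidHom.fst N L) z ∧
        realMap (thetaProj ω σ) y = realMap φ (realMap (AddMonoidHom.snd N L) z) := by
  -- Only the two linear conditions go through the induction; `y` lies in the cone afterwards, since
  -- that cone is the preimage of `σ` and `y` maps into `σ`.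
  obtain ⟨y, hy, hy'⟩ := hω.induction (P := fun z => ∃ y : RealSpace (coneLattice σ),
      realMap (coneLattice σ).subtype y = realMap (AddMonoidHom.fst N L) z ∧
        realMap (thetaProj ω σ) y = realMap φ (realMap (AddMonoidHom.snd N L) z))
    ⟨0, by simp⟩
    (fun z z' ⟨y, h₁, h₂⟩ ⟨y', h₁', h₂'⟩ => ⟨y + y', by simp only [map_add, h₁, h₁'],
      by simp only [map_add, h₂, h₂']⟩)
    (fun a z ⟨y, h₁, h₂⟩ => ⟨a • y, by simp only [map_smul, h₁], by simp only [map_smul, h₂]⟩)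
    (fun ⟨n, l⟩ h => by
      have hnl := mem_coneLattice_of_mem h
      refine ⟨latticePoint ⟨n, map_mem_coneLattice hr hnl⟩, ?_, ?_⟩
      · simp only [realMap_latticePoint]; rfl
      · simp only [realMap_latticePoint]
        exact congrArg _ (hφ n l hnl _).symm) hz
  exact ⟨y, (congrArg (· ∈ σ) hy).mpr (hr z hz), hy, hy'⟩

lemma IsPositionHom.isPositionMap (hφ : IsPositionHom φ)
    (hr : ∀ x ∈ ω, realMap (AddMonoidHom.fst N L) x ∈ σ) (hω : IsRationalPolyhedral ω)
    {τ : LatticeCone L} : IsPositionMap τ ω σ φ := by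
  rintro f - x ⟨z, hz, rfl, rfl⟩
  exact hφ.exists_mem_coneInLattice hr hω hz

/-- Surjectivity of `ω → τ` makes every polyhedron nonempty, which fixes the map on `τ`; then `τ`
spans, and a map into a free lattice is determined by its real extension. -/
lemma IsPositionMap.unique [Module.Free ℤ (ThetaLattice ω σ)] {τ : LatticeCone L}
    (hτ : Submodule.span ℝ (τ : Set (RealSpace L)) = ⊤)
    (hp : PointedCone.map (realMap (AddMonoidHom.snd N L)) ω = τ) {ψ : L →+ ThetaLattice ω σ}
    (hφ : IsPositionMap τ ω σ φ) (hψ : IsPositionMap τ ω σ ψ) : ψ = φ := by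
  have heq : Set.EqOn (realMap ψ) (realMap φ) τ := fun f hf => by
    obtain ⟨z, hz, hzf⟩ : f ∈ PointedCone.map (realMap (AddMonoidHom.snd N L)) ω := hp ▸ hf
    obtain ⟨y, -, hy, hy'⟩ := hφ f hf _ ⟨z, hz, rfl, hzf⟩
    obtain ⟨y', -, h, h'⟩ := hψ f hf _ ⟨z, hz, rfl, hzf⟩
    -- The two witnesses lie over the same point of `N_ℝ`, hence coincide in `N_σ ⊗ ℝ`.
    rw [← hy', ← h', realMap_injective (Subtype.val_injective) (hy.trans h.symm)]
  ext l
  apply latticePoint_injective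
  rw [← realMap_latticePoint, ← realMap_latticePoint,
    LinearMap.ext_on hτ heq]

end Position
end Theta

/-! ### The split exact sequence of character groups -/

section Splitting
variable {N L : Type u} [AddCommGroup N] [AddCommGroup L] {ω : LatticeCone (N × L)}
  {σ : LatticeCone N} {φ : L →+ ThetaLattice ω σ}

/-- Characters in `σ^⊥` vanish on `N_σ`. Dually, `T_θ` acts along the fibres of `O_ω → O_σ`. -/
lemma thetaChar_perpPullback (hr : ∀ x ∈ ω, realMap (AddMonoidHom.fst N L) x ∈ σ) :
    (thetaChar ω σ).comp (perpPullback (AddMonoidHom.fst N L) hr) = 0 := by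
  ext m : 1
  refine QuotientAddGroup.addMonoidHom_ext _ (AddMonoidHom.ext fun x => ?_)
  exact neg_eq_zero.2 (apply_eq_zero_of_mem_coneLattice m.2 x.2)

/-- Lift `l` to `(n, l) ∈ N_ω`. Then `m(n, l) = 0`, so `m(0, l) = -m(n, 0)`, and the sign in
`thetaChar` absorbs the minus. -/
lemma IsPositionHom.thetaChar_apply (hφ : IsPositionHom φ)
    (hr : ∀ x ∈ ω, realMap (AddMonoidHom.fst N L) x ∈ σ)
    (hs : (coneLattice ω).map (AddMonoidHom.snd N L) = ⊤) (m : perp ω) (l : L) :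
    thetaChar ω σ m (φ l) = m.1 (0, l) := by
  obtain ⟨⟨n, l⟩, h, rfl⟩ : l ∈ (coneLattice ω).map (AddMonoidHom.snd N L) := hs ▸ trivial
  have h0 : m.1 (n, l) = 0 := apply_eq_zero_of_mem_coneLattice m.2 h
  have h1 : m.1 (n, l) = m.1 (n, 0) + m.1 (0, l) := by rw [← map_add]; simp
  change thetaChar ω σ m (φ l) = m.1 (0, l)
  rw [hφ n l h (map_mem_coneLattice hr h), thetaChar_thetaProj]
  change -m.1 (n, 0) = _
  omega

/-- The sequence `0 → σ^⊥ → ω^⊥ → Hom(N_θ, ℤ) → 0` splits: a retraction `r : N → N_σ` gives a section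
`c ↦ c ∘ (φ ∘ pr₂ - r ∘ pr₁)` of the second map. -/
lemma IsPositionHom.exists_splitting [Module.Finite ℤ N] (hφ : IsPositionHom φ)
    (hr : ∀ x ∈ ω, realMap (AddMonoidHom.fst N L) x ∈ σ)
    (hs : (coneLattice ω).map (AddMonoidHom.snd N L) = ⊤) (hω : IsRationalPolyhedral ω)
    (hσ : IsRationalPolyhedral σ) :
    ∃ (sect : CharLattice (ThetaLattice ω σ) →+ perp ω) (retr : perp ω →+ perp σ),
      (thetaChar ω σ).comp sect = AddMonoidHom.id _ ∧
      retr.comp (perpPullback (AddMonoidHom.fst N L) hr) = AddMonoidHom.id _ ∧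
      retr.comp sect = 0 ∧
      sect.comp (thetaChar ω σ) + (perpPullback (AddMonoidHom.fst N L) hr).comp retr =
        AddMonoidHom.id _ := by
  obtain ⟨r, hret⟩ := exists_retraction_coneLattice σ
  have hrr : ∀ n, r (r n) = r n := fun n => hret _ (r n).2
  -- On `(n, l) ∈ N_ω` the retraction fixes `n` and `φ l` is the class of `n`. So `κ` kills `N_ω`,
  -- and composing with it produces characters in `ω^⊥`.
  let κ : N × L →+ ThetaLattice ω σ := φ.comp (AddMonoidHom.snd N L) -
    ((thetaProj ω σ).comp r).comp (AddMonoidHom.fst N L)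
  have hκ : ∀ x ∈ coneLattice ω, κ x = 0 := fun ⟨n, l⟩ h => by
    change φ l - thetaProj ω σ (r n) = 0
    rw [hφ n l h (map_mem_coneLattice hr h), hret n (map_mem_coneLattice hr h), sub_self]
  let sect : CharLattice (ThetaLattice ω σ) →+ perp ω := (AddMonoidHom.compHom' κ).codRestrict _
    fun c => mem_perp_of_coneLattice hω fun x hx => by
      change c (κ x) = 0
      rw [hκ x hx, map_zero]
  -- The complementary projection `id - r` kills `N_σ`, so composing with `ε` produces characters in
  -- `σ^⊥`.
  let ε : N →+ N × L := (AddMonoidHom.inl N L).comp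
    (AddMonoidHom.id N - (coneLattice σ).subtype.comp r)
  have hε : ∀ n ∈ coneLattice σ, ε n = 0 := fun n hn => by
    change AddMonoidHom.inl N L (n - r n) = 0
    rw [hret n hn, sub_self, map_zero]
  let retr : perp ω →+ perp σ := ((AddMonoidHom.compHom' ε).comp (perp ω).subtype).codRestrict _
    fun m => mem_perp_of_coneLattice hσ fun n hn => by
      change m.1 (ε n) = 0
      rw [hε n hn, map_zero]
  refine ⟨sect, retr, ?_, ?_, ?_, ?_⟩
  · ext c : 1
    refine QuotientAddGroup.addMonoidHom_ext _ (AddMonoidHom.ext fun x => ?_)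
    change -c (φ 0 - thetaProj ω σ (r x)) = c (thetaProj ω σ x)
    rw [map_zero, zero_sub, map_neg, neg_neg, hret x x.2]
  · ext m n
    change m.1 (n - r n) = m.1 n
    rw [map_sub, apply_eq_zero_of_mem_coneLattice m.2 (r n).2, sub_zero]
  · ext c n
    change c (φ 0 - thetaProj ω σ (r (n - r n))) = 0
    rw [map_sub r, hrr, sub_self, map_zero, map_zero, sub_self, map_zero]
  · ext1 m
    refine Subtype.ext (AddMonoidHom.ext fun ⟨n, l⟩ => ?_)
    -- The three contributions are `m(0, l)`, `m(r n, 0)` and `m(n - r n, 0)`, with sum `m(n, l)`.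
    change thetaChar ω σ m (φ l - thetaProj ω σ (r n)) + m.1 (n - r n, 0) = m.1 (n, l)
    rw [map_sub, hφ.thetaChar_apply hr hs, thetaChar_thetaProj, sub_neg_eq_add, add_assoc,
      ← map_add, ← map_add]
    simp

end Splitting

/-! ### The principal bundle and the actions on the stratum -/

section Bundle
variable {k : Type u} [Field k] {N L : Type u} [AddCommGroup N] [AddCommGroup L]
  {ω : LatticeCone (N × L)} {σ : LatticeCone N} {φ : L →+ ThetaLattice ω σ}

variable (k ω σ) in
/-- The homomorphism `T_θ → O_ω` through which `T_θ` acts on `O_ω`. -/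
def thetaTorusToOrbit : torus k (ThetaLattice ω σ) ⟶ orbit k ω := diagMap k (thetaChar ω σ)

instance : IsMonHom (thetaTorusToOrbit k ω σ) := isMonHom_diagMap (thetaChar ω σ)

variable (k ω σ) in
/-- The action of `T_θ` on `O_ω`. -/
@[reducible]
def thetaAction : ModObj (torus k (ThetaLattice ω σ)) (orbit k ω) :=
  translationAction (thetaTorusToOrbit k ω σ)

instance {N' : Type u} [AddCommGroup N'] (f : N →+ N') {ρ : LatticeCone N} {ρ' : LatticeCone N'}
    (h : ∀ x ∈ ρ, realMap f x ∈ ρ') : IsMonHom (orbitMap k f h) :=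
  isMonHom_diagMap (perpPullback f h)

lemma IsPositionHom.isPrincipalBundle [Module.Finite ℤ N] (hφ : IsPositionHom φ)
    (hr : ∀ x ∈ ω, realMap (AddMonoidHom.fst N L) x ∈ σ)
    (hs : (coneLattice ω).map (AddMonoidHom.snd N L) = ⊤) (hω : IsRationalPolyhedral ω)
    (hσ : IsRationalPolyhedral σ) :
    let := thetaAction k ω σ
    IsPrincipalBundle k (G := torus k (ThetaLattice ω σ))
      (orbitMap k (AddMonoidHom.fst N L) hr) := by
  obtain ⟨sect, retr, h₁, h₂, h₃, h₄⟩ := hφ.exists_splitting hr hs hω hσ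
  let q : orbit k ω ⟶ torus k (ThetaLattice ω σ) := diagMap k sect
  let s : orbit k σ ⟶ orbit k ω := diagMap k retr
  have : IsMonHom q := isMonHom_diagMap sect
  have : IsMonHom s := isMonHom_diagMap retr
  -- Each condition on morphisms is the dual of one identity of the split sequence of characters.
  refine isPrincipalBundle_of_split _ _ ?_ q s ?_ ?_ ?_ ?_
  · exact (diagMap_comp _ _).trans ((congrArg _ (thetaChar_perpPullback hr)).trans diagMap_zero)
  · exact (diagMap_comp _ _).trans ((congrArg _ h₁).trans diagMap_id)
  · exact (diagMap_comp _ _).trans ((congrArg _ h₂).trans diagMap_id)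
  · exact (diagMap_comp _ _).trans ((congrArg _ h₃).trans diagMap_zero)
  · exact (congrArg₂ _ (diagMap_comp _ _) (diagMap_comp _ _)).trans
      ((diagMap_mul _ _).trans ((congrArg _ h₄).trans diagMap_id))

/-- An action of `T` on `O_ω` by torus translations that factors through `T_θ` is the restriction of
the torus action. -/
lemma Fan.whiskerRight_actionMap_orbitι (Ups : Fan (N × L)) (ω : Ups.cones) {T : SchemeOver k}
    (a : T ⟶ torus k (ThetaLattice ω.1 σ)) (b : T ⟶ torus k (N × L))
    (h : a ≫ thetaTorusToOrbit k ω.1 σ = b ≫ torusToOrbit k ω.1) :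
    let := thetaAction k ω.1 σ
    a ▷ orbit k ω.1 ≫ actionMap (torus k (ThetaLattice ω.1 σ)) (orbit k ω.1) ≫ Ups.orbitι k ω =
      (b ⊗ₘ Ups.orbitι k ω) ≫ Ups.torusAction k := by
  intro
  rw [Ups.tensor_orbitι_torusAction, ← h, comp_whiskerRight, Category.assoc]
  change a ▷ orbit k ω.1 ≫ (thetaTorusToOrbit k ω.1 σ ▷ orbit k ω.1 ≫ μ[orbit k ω.1]) ≫ _ = _
  rw [Category.assoc]

/-- The sign of `-thetaProj` cancels the one in `thetaChar`: this is the rule that `t` acts as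
`t⁻¹`. -/
lemma torusMap_neg_thetaProj_comp :
    torusMap k (-thetaProj ω σ) ≫ thetaTorusToOrbit k ω σ =
      torusMap k ((AddMonoidHom.inl N L).comp (coneLattice σ).subtype) ≫ torusToOrbit k ω := by
  refine (diagMap_comp _ _).trans (Eq.trans (congrArg _ ?_) (diagMap_comp _ _).symm)
  ext m x
  change thetaChar ω σ m (-thetaProj ω σ x) = m.1 (x, 0)
  rw [map_neg, thetaChar_thetaProj, neg_neg]

/-- The dual of `IsPositionHom.thetaChar_apply`: the rubber torus translates `O_ω` through `T_θ`. -/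
lemma IsPositionHom.torusMap_comp (hφ : IsPositionHom φ)
    (hr : ∀ x ∈ ω, realMap (AddMonoidHom.fst N L) x ∈ σ)
    (hs : (coneLattice ω).map (AddMonoidHom.snd N L) = ⊤) :
    torusMap k φ ≫ thetaTorusToOrbit k ω σ =
      torusMap k (AddMonoidHom.inr N L) ≫ torusToOrbit k ω := by
  refine (diagMap_comp _ _).trans (Eq.trans (congrArg _ ?_) (diagMap_comp _ _).symm)
  ext m l
  exact hφ.thetaChar_apply hr hs m l

end Bundle

end Toric

end

/-! ### Assembly of the theorem -/

theorem theorem1p4 {k : Type u} [Field k] [IsAlgClosed k] [CharZero k]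
    {N L : Type u} [AddCommGroup N] [Module.Free ℤ N] [Module.Finite ℤ N]
    [AddCommGroup L] [Module.Free ℤ L] [Module.Finite ℤ L]
    (Sig : Fan N) (τ : LatticeCone L) (hτ : IsRationalPolyhedral τ)
    (hτspan : Submodule.span ℝ (τ : Set (RealSpace L)) = ⊤)
    (Ups : Fan (N × L)) (hUps : IsTropicalExpansion Sig τ Ups)
    (ω : Ups.cones) (hω : PointedCone.map (realMap (AddMonoidHom.snd N L)) ω.1 = τ) :
    ∃ σ : Sig.cones,
      IsLeast {ρ : Sig.cones | ∀ x ∈ ω.1, realMap (AddMonoidHom.fst N L) x ∈ ρ.1} σ ∧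
      (∃ g : orbit k ω.1 ⟶ orbit k τ,
        Ups.orbitι k ω ≫ hUps.projection k = g ≫ orbitToChart k τ) ∧
      Module.Free ℤ (ThetaLattice ω.1 σ.1) ∧
      ∃ (p : orbit k ω.1 ⟶ orbit k σ.1)
        (_ : ModObj (torus k (ThetaLattice ω.1 σ.1)) (orbit k ω.1)),
        p ≫ Sig.orbitι k σ = Ups.orbitι k ω ≫ hUps.collapse k ∧
        IsPrincipalBundle k (G := torus k (ThetaLattice ω.1 σ.1)) p ∧
        Toric.torusMap k (-thetaProj ω.1 σ.1) ▷ orbit k ω.1 ≫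
            actionMap (torus k (ThetaLattice ω.1 σ.1)) (orbit k ω.1) ≫
            Ups.orbitι k ω =
          (Toric.torusMap k ((AddMonoidHom.inl N L).comp (coneLattice σ.1).subtype) ⊗ₘ
            Ups.orbitι k ω) ≫ Ups.torusAction k ∧
        ∃ φ : L →+ ThetaLattice ω.1 σ.1,
          IsPositionMap τ ω.1 σ.1 φ ∧
          (∀ ψ, IsPositionMap τ ω.1 σ.1 ψ → ψ = φ) ∧
          (∀ f ∈ τ, realMap φ f ∈ thetaCone ω.1 σ.1) ∧
          torus k L ◁ Ups.orbitι k ω ≫ rubberAction k Ups =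
            Toric.torusMap k φ ▷ orbit k ω.1 ≫
              actionMap (torus k (ThetaLattice ω.1 σ.1)) (orbit k ω.1) ≫
              Ups.orbitι k ω := by
  have hωr := Ups.rational _ ω.2
  -- Saturation identifies the image of `N_ω` with `N_τ`, which is all of `L` because `τ` is
  -- full-dimensional.
  have hs : (coneLattice ω.1).map (AddMonoidHom.snd N L) = ⊤ := by
    rw [hUps.saturated _ ω.2, hω, coneLattice_eq_top hτspan]
  obtain ⟨σ, hleast⟩ : ∃ σ : Sig.cones,
      IsLeast {ρ : Sig.cones | ∀ x ∈ ω.1, realMap (AddMonoidHom.fst N L) x ∈ ρ.1} σ := by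
    have h := Sig.exists_isLeast (realMap (AddMonoidHom.fst N L) '' ω.1) (by
      obtain ⟨σ, hσ, h⟩ := hUps.compatible _ ω.2
      exact ⟨σ, hσ, Set.image_subset_iff.2 h⟩)
    simpa only [Set.image_subset_iff] using! h
  have hr := hleast.1
  have hσr := Sig.rational _ σ.2
  have hperp : ∀ m ∈ dualMonoid σ.1, m.comp (AddMonoidHom.fst N L) ∈ perp ω.1 →
      m ∈ perp σ.1 := fun m hm h =>
    Sig.mem_perp_of_isLeast (A := realMap (AddMonoidHom.fst N L) '' ω.1)
      (by simpa only [Set.image_subset_iff] using! hleast) hm (by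
        rintro _ ⟨x, hx, rfl⟩
        exact (pairing_realMap _ m x).trans (h x hx))
  -- No minimality is needed here: `ω` surjects onto `τ`, so vanishing on `ω` after pullback is
  -- vanishing on `τ`.
  have hperp' : ∀ m ∈ dualMonoid τ, m.comp (AddMonoidHom.snd N L) ∈ perp ω.1 → m ∈ perp τ := by
    intro m _ h x hx
    rw [← hω] at hx
    obtain ⟨z, hz, rfl⟩ := hx
    exact (pairing_realMap (AddMonoidHom.snd N L) m z).trans (h z hz)
  have hfree : Module.Free ℤ (ThetaLattice ω.1 σ.1) := free_thetaLattice
  obtain ⟨φ, hφ⟩ := exists_isPositionHom hr hs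
  have hpos : IsPositionMap τ ω.1 σ.1 φ := hφ.isPositionMap hr hωr
  refine ⟨σ, hleast, ⟨orbitMap k (AddMonoidHom.snd N L) (hUps.snd_mem _ ω.2), ?_⟩, hfree,
    orbitMap k (AddMonoidHom.fst N L) hr, thetaAction k ω.1 σ.1, ?_,
    hφ.isPrincipalBundle hr hs hωr hσr,
    Ups.whiskerRight_actionMap_orbitι ω _ _ torusMap_neg_thetaProj_comp, φ, hpos,
    fun ψ hψ => hpos.unique hτspan hω hψ, fun f hf => ?_, ?_⟩
  · rw [orbitMap_orbitToChart _ _ hperp', Fan.orbitι, Category.assoc,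
      IsTropicalExpansion.projection, Fan.mapToAffine, Fan.chartι_desc]
  · rw [Fan.orbitι, ← Category.assoc, orbitMap_orbitToChart _ _ hperp, Fan.orbitι, Category.assoc,
      Category.assoc, IsTropicalExpansion.collapse, hUps.compatible.chartι_map k ω σ hr]
  · obtain ⟨z, hz, hzf⟩ : f ∈ PointedCone.map (realMap (AddMonoidHom.snd N L)) ω.1 := hω ▸ hf
    obtain ⟨y, hy, -, hyf⟩ := hpos f hf _ ⟨z, hz, rfl, hzf⟩
    exact ⟨y, hy, hyf⟩
  -- Both sides are now the big torus acting through the inclusion of the second factor, up to the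
  -- interchange law.
  · rw [Ups.whiskerRight_actionMap_orbitι ω _ _ (hφ.torusMap_comp hr hs), rubberAction,
      ← Category.assoc, MonoidalCategory.tensorHom_def, ← whisker_exchange]
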